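/- **Theorem 1.** Model checking stateless probabilistic pushdown processes (pBPA) against PCTL is undecidable, both for regular valuations and already for simple valuations. In detail: A *pBPA* $\Delta=(\Gamma,\delta,\mathcal P)$ consists of a finite stack alphabet $\Gamma$, a finite set $\delta$ of rules $X\to\alpha$ with $X\in\Gamma$, $\alpha\in\Gamma^*$, $|\alpha|\le 2$, with at least one rule for each $X\in\Gamma$, and rational probabilities $\mathcal P(X\to\alpha)\in(0,1]$ with $\sum_{X\to\alpha}\mathcal P(X\to\alpha)=1$ for each $X$. It induces a Markov chain $\mathcal M_\Delta$ with state set $\Gamma^*$ (the leftmost letter is the top of the stack): $X\beta$ moves to $\alpha\beta$ with probability $\mathcal P(X\to\alpha)$, and the empty stack $\varepsilon$ moves to itself with probability $1$. *PCTL* state formulas over a finite set $AP$ of propositions are given by $$\Phi::=\mathbf{true}\mid p\mid\neg\Phi\mid\Phi_1\wedge\Phi_2\mid\mathcal P_{\bowtie r}(\mathbf X\Phi)\mid\mathcal P_{\bowtie r}(\Phi_1\mathbf U\Phi_2),\qquad p\in AP,\ \bowtie\,\in\{>,=\},\ r\in\mathbb Q\cap[0,1].$$ For a valuation $\nu:AP\to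 2^{\Gamma^*}$, $\mathcal M_\Delta,s\models^\nu p$ means $s\in\nu(p)$; $\mathbf{true}$, $\neg$ and $\wedge$ are as usual; and $\mathcal M_\Delta,s\models^\nu\mathcal P_{\bowtie r}(\varphi)$ means that the probability that a run $\omega$ of $\mathcal M_\Delta$ started in $s$ satisfies $\varphi$ is $\bowtie r$. Here $\omega$ satisfies $\mathbf X\Phi$ if $\omega(1)$ satisfies $\Phi$, and $\Phi_1\mathbf U\Phi_2$ if for some $k\ge0$ the state $\omega(k)$ satisfies $\Phi_2$ and $\omega(j)$ satisfies $\Phi_1$ for all $0\le j<k$. The valuation $\nu$ is *regular* if for each $p$ the set $\nu(p)$, with stacks read from bottom to top, is the language of a given deterministic finite automaton. It is *simple* if for each $p$ there is a given set $H_p\subseteq\Gamma\cup\{\varepsilon\}$ of heads such that a nonempty stack is in $\nu(p)$ iff its top symbol is in $H_p$, and the empty stack is in $\nu(p)$ iff $\varepsilon\in H_p$. Then there is no algorithm that, given a pBPA $\Delta$, an initial stack symbol $Z\in\Gamma$, a simple valuation $\nu$ (by its sets of heads) and a PCTL formula $\Phi$, decides whether $\mathcal M_\Delta,Z\models^\nu\Phi$.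 Likewise there is no such algorithm for regular valuations (given by finite automata). -/

import Mathlib

open MeasureTheory ProbabilityTheory
open scoped ENNReal

/-! ### Markov chains and their runs -/

/-- A discrete Markov chain on `S`: every state has a probability distribution on its successors.
The transition relation is `{(s, t) | t ∈ (M s).support}`. -/
abbrev MarkovChain (S : Type) := S → PMF S

namespace MarkovChain

variable {S : Type} [MeasurableSpace S] [DiscreteMeasurableSpace S] [Countable S]

/-- The one-step kernel of a Markov chain. -/
noncomputable def kernel (M : MarkovChain S) : Kernel S S where
  toFun s := (M s).toMeasure
  measurable' := .of_discrete

instance (M : MarkovChain S) : IsMarkovKernel M.kernel :=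
  ⟨fun s => inferInstanceAs (IsProbabilityMeasure (M s).toMeasure)⟩

/-- The next state given a finite history: it depends on the last state of the history only. -/
noncomputable def historyKernel (M : MarkovChain S) (m : ℕ) :
    Kernel ((i : Finset.Iic m) → S) S :=
  M.kernel.comap (fun h => h ⟨m, Finset.mem_Iic.2 le_rfl⟩) (measurable_pi_apply _)

instance (M : MarkovChain S) (m : ℕ) : IsMarkovKernel (M.historyKernel m) :=
  inferInstanceAs (IsMarkovKernel (M.kernel.comap _ _))

/-- The probability measure on infinite sequences of states, for runs that start in `s`. -/
noncomputable def runMeasure (M : MarkovChain S) (s : S) : Measure (ℕ → S) :=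
  Kernel.traj (X := fun _ => S) M.historyKernel 0 (fun _ => s)

end MarkovChain

/-! ### PCTL -/

/-- The comparisons `>` and `=` allowed in the probability operator. -/
inductive Cmp
  | gt
  | eq

/-- `x ⋈ r`. -/
def Cmp.Holds : Cmp → ℝ → ℚ → Prop
  | .gt, x, r => x > r
  | .eq, x, r => x = r

/-- PCTL state formulas over the atomic propositions `AP`. The two kinds of path formulas,
`X Φ` and `Φ₁ U Φ₂`, occur only directly below a probability operator `P_{⋈ r}`, so
`P_{⋈ r}(X Φ)` and `P_{⋈ r}(Φ₁ U Φ₂)` are the last two constructors. -/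
inductive PCTL (AP : Type)
  | tru : PCTL AP
  | atom (p : AP) : PCTL AP
  | neg (Φ : PCTL AP) : PCTL AP
  | and (Φ₁ Φ₂ : PCTL AP) : PCTL AP
  | probNext (c : Cmp) (r : Set.Icc (0 : ℚ) 1) (Φ : PCTL AP) : PCTL AP
  | probUntil (c : Cmp) (r : Set.Icc (0 : ℚ) 1) (Φ₁ Φ₂ : PCTL AP) : PCTL AP

/-- `M, s ⊨^ν Φ`. -/
def PCTL.Sat {AP S : Type} [MeasurableSpace S] [DiscreteMeasurableSpace S] [Countable S]
    (M : MarkovChain S) (ν : AP → Set S) : PCTL AP → S → Prop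
  | .tru, _ => True
  | .atom p, s => s ∈ ν p
  | .neg Φ, s => ¬ Φ.Sat M ν s
  | .and Φ₁ Φ₂, s => Φ₁.Sat M ν s ∧ Φ₂.Sat M ν s
  | .probNext c r Φ, s => c.Holds ((M.runMeasure s).real {ω | Φ.Sat M ν (ω 1)}) r
  | .probUntil c r Φ₁ Φ₂, s =>
      c.Holds ((M.runMeasure s).real
        {ω | ∃ k, Φ₂.Sat M ν (ω k) ∧ ∀ j < k, Φ₁.Sat M ν (ω j)}) r

/-! ### Stateless probabilistic pushdown processes -/

/-- A stateless probabilistic pushdown process with stack alphabet `Fin n` and rational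
probabilities. `rules X` lists the right-hand sides `α` of the rules `X → α`, and `prob X α`
is the probability of that rule (and `0` if there is no such rule). -/
structure PBPA (n : ℕ) where
  rules : Fin n → List (List (Fin n))
  prob : Fin n → List (Fin n) → ℚ
  nodup : ∀ X, (rules X).Nodup
  exists_rule : ∀ X, ∃ α, α ∈ rules X
  length_le : ∀ X, ∀ α ∈ rules X, α.length ≤ 2
  prob_mem : ∀ X, ∀ α ∈ rules X, 0 < prob X α ∧ prob X α ≤ 1
  prob_eq_zero : ∀ X α, α ∉ rules X → prob X α = 0
  sum_prob : ∀ X, ∑ α ∈ (rules X).toFinset, prob X α = 1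

/-- Configurations are stack contents, with the top of the stack at the head of the list. -/
abbrev Config (n : ℕ) := List (Fin n)

instance (n : ℕ) : MeasurableSpace (Config n) := ⊤

instance (n : ℕ) : DiscreteMeasurableSpace (Config n) := ⟨fun _ => trivial⟩

namespace PBPA

variable {n : ℕ}

/-- The distribution on the right-hand sides of the rules for `X`. -/
noncomputable def ruleDist (Δ : PBPA n) (X : Fin n) : PMF (List (Fin n)) :=
  PMF.ofFinset (fun α => ENNReal.ofReal (Δ.prob X α)) (Δ.rules X).toFinset
    (by
      rw [← ENNReal.ofReal_sum_of_nonneg]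
      · rw [← Rat.cast_sum, Δ.sum_prob X]; simp
      · intro α hα
        exact_mod_cast (Δ.prob_mem X α (List.mem_toFinset.1 hα)).1.le)
    (by
      intro α hα
      rw [Δ.prob_eq_zero X α (fun h => hα (List.mem_toFinset.2 h))]
      simp)

/-- The Markov chain on configurations: `Xβ` goes to `αβ` with the probability of `X → α`;
the empty stack, where no rule applies, stays put. -/
noncomputable def chain (Δ : PBPA n) : MarkovChain (Config n)
  | [] => PMF.pure []
  | X :: β => (Δ.ruleDist X).map (· ++ β)

end PBPA

/-! ### Valuations -/

/-- A simple valuation of `k` propositions: a set of heads for each of them, where a head is the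
top stack symbol, or `none` for the empty stack. -/
abbrev SimpleValuation (n k : ℕ) := Fin k → Option (Fin n) → Bool

/-- The configurations where a proposition holds under a simple valuation. -/
def SimpleValuation.toSet {n k : ℕ} (H : SimpleValuation n k) (p : Fin k) : Set (Config n) :=
  {w | H p w.head? = true}

/-- An explicitly given deterministic finite automaton over the alphabet `Fin n`. -/
structure FinDFA (n : ℕ) where
  size : ℕ
  step : Fin size → Fin n → Fin size
  start : Fin size
  accept : Fin size → Bool

/-- The automaton as a `DFA`. -/
def FinDFA.toDFA {n : ℕ} (A : FinDFA n) : DFA (Fin n) (Fin A.size) where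
  step := A.step
  start := A.start
  accept := {q | A.accept q = true}

/-- A regular valuation of `k` propositions: a finite automaton for each of them. -/
abbrev RegularValuation (n k : ℕ) := Fin k → FinDFA n

/-- The configurations where a proposition holds under a regular valuation. The automaton reads
the stack from bottom to top. -/
def RegularValuation.toSet {n k : ℕ} (A : RegularValuation n k) (p : Fin k) : Set (Config n) :=
  {w | w.reverse ∈ (A p).toDFA.accepts}

/-! ### The model-checking problems -/

/-- An instance of the model-checking problem, with valuations presented by `V n k`. The
initial configuration is the single stack symbol `init`. -/
structure MCInstance (V : ℕ → ℕ → Type) where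
  n : ℕ
  k : ℕ
  Δ : PBPA n
  init : Fin n
  ν : V n k
  Φ : PCTL (Fin k)

/-- The question of the model-checking problem for simple valuations. -/
def MCInstance.SimpleSat (I : MCInstance SimpleValuation) : Prop :=
  I.Φ.Sat I.Δ.chain I.ν.toSet [I.init]

/-- The question of the model-checking problem for regular valuations. -/
def MCInstance.RegularSat (I : MCInstance RegularValuation) : Prop :=
  I.Φ.Sat I.Δ.chain I.ν.toSet [I.init]

/-! ### Inputs as finite data -/

/-- For every stack symbol the list of its rules, each with numerator and denominator of its
probability. -/
def PBPA.code {n : ℕ} (Δ : PBPA n) : List (List (List ℕ × ℕ × ℕ)) :=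
  List.ofFn fun X => (Δ.rules X).map fun α =>
    (α.map Fin.val, (Δ.prob X α).num.natAbs, (Δ.prob X α).den)

/-- Code of a comparison. -/
def Cmp.code : Cmp → ℕ
  | .gt => 0
  | .eq => 1

/-- A formula in prefix notation. -/
def PCTL.code {k : ℕ} : PCTL (Fin k) → List ℕ
  | .tru => [0]
  | .atom p => [1, p.val]
  | .neg Φ => 2 :: Φ.code
  | .and Φ₁ Φ₂ => 3 :: (Φ₁.code ++ Φ₂.code)
  | .probNext c r Φ => 4 :: c.code :: r.1.num.natAbs :: r.1.den :: Φ.code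
  | .probUntil c r Φ₁ Φ₂ =>
      5 :: c.code :: r.1.num.natAbs :: r.1.den :: (Φ₁.code ++ Φ₂.code)

/-- For every proposition the truth value at the empty stack and the table of truth values for
the top stack symbols. -/
def SimpleValuation.code {n k : ℕ} (H : SimpleValuation n k) : List (Bool × List Bool) :=
  List.ofFn fun p => (H p none, List.ofFn fun X => H p (some X))

/-- The start state and, for every state, the acceptance flag and the row of the transition
table. -/
def FinDFA.code {n : ℕ} (A : FinDFA n) : ℕ × List (Bool × List ℕ) :=
  (A.start.val, List.ofFn fun q => (A.accept q, List.ofFn fun X => (A.step q X).val))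

/-- The list of the automata. -/
def RegularValuation.code {n k : ℕ} (A : RegularValuation n k) :
    List (ℕ × List (Bool × List ℕ)) :=
  List.ofFn fun p => (A p).code

/-- The input that presents an instance with a simple valuation. -/
def MCInstance.simpleCode (I : MCInstance SimpleValuation) :
    List (List (List ℕ × ℕ × ℕ)) × ℕ × List (Bool × List Bool) × List ℕ :=
  (I.Δ.code, I.init.val, I.ν.code, I.Φ.code)

/-- The input that presents an instance with a regular valuation. -/
def MCInstance.regularCode (I : MCInstance RegularValuation) :
    List (List (List ℕ × ℕ × ℕ)) × ℕ × List (ℕ × List (Bool × List ℕ)) × List ℕ :=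
  (I.Δ.code, I.init.val, I.ν.code, I.Φ.code)

/-- The problem `Q`, whose instances are presented as inputs by `code`, is decidable: some
algorithm gives the right answer on the input of every instance. Nothing is asked of it on
inputs that present no instance. -/
def DecidableProblem {ι C : Type} [Primcodable C] (code : ι → C) (Q : ι → Prop) : Prop :=
  ∃ f : C → Bool, Computable f ∧ ∀ i, f (code i) = true ↔ Q i

/-! ### The inputs determine the instances -/

theorem Cmp.code_injective : Function.Injective Cmp.code := by
  intro a b h; cases a <;> cases b <;> simp_all [Cmp.code]

theorem rat_eq_of_code {p q : ℚ} (hp : 0 ≤ p) (hq : 0 ≤ q)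
    (h₁ : p.num.natAbs = q.num.natAbs) (h₂ : p.den = q.den) : p = q := by
  have := Rat.num_nonneg.2 hp
  have := Rat.num_nonneg.2 hq
  exact Rat.ext (by omega) h₂

/-- The prefix notation is uniquely readable. -/
theorem PCTL.code_append_inj {k : ℕ} (Φ : PCTL (Fin k)) : ∀ (Ψ : PCTL (Fin k)) (l l' : List ℕ),
    Φ.code ++ l = Ψ.code ++ l' → Φ = Ψ ∧ l = l' := by
  induction Φ with
  | tru => intro Ψ l l' h; cases Ψ <;> simp_all [PCTL.code]
  | atom p => intro Ψ l l' h; cases Ψ <;> simp_all [PCTL.code, Fin.ext_iff]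
  | neg Φ ih =>
    intro Ψ l l' h
    cases Ψ <;> simp [PCTL.code] at h
    obtain ⟨h, h'⟩ := ih _ _ _ h
    simp [h, h']
  | and Φ₁ Φ₂ ih₁ ih₂ =>
    intro Ψ l l' h
    cases Ψ <;> simp [PCTL.code] at h
    obtain ⟨h, h'⟩ := ih₁ _ _ _ h
    obtain ⟨h', h''⟩ := ih₂ _ _ _ h'
    simp [h, h', h'']
  | probNext c r Φ ih =>
    intro Ψ l l' h
    cases Ψ <;> simp [PCTL.code] at h
    rename_i c' r' _
    obtain ⟨hc, h₁, h₂, h⟩ := h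
    obtain ⟨h, h'⟩ := ih _ _ _ h
    simp [h, h', Cmp.code_injective hc, Subtype.ext (rat_eq_of_code r.2.1 r'.2.1 h₁ h₂)]
  | probUntil c r Φ₁ Φ₂ ih₁ ih₂ =>
    intro Ψ l l' h
    cases Ψ <;> simp [PCTL.code] at h
    rename_i c' r' _ _
    obtain ⟨hc, h₁, h₂, h⟩ := h
    obtain ⟨h, h'⟩ := ih₁ _ _ _ h
    obtain ⟨h', h''⟩ := ih₂ _ _ _ h'
    simp [h, h', h'', Cmp.code_injective hc,
      Subtype.ext (rat_eq_of_code r.2.1 r'.2.1 h₁ h₂)]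

theorem PCTL.code_injective {k : ℕ} : Function.Injective (PCTL.code (k := k)) :=
  fun Φ Ψ h => (Φ.code_append_inj Ψ [] [] (by simpa using h)).1

theorem PBPA.prob_nonneg {n : ℕ} (Δ : PBPA n) (X : Fin n) (α : List (Fin n)) :
    0 ≤ Δ.prob X α := by
  by_cases h : α ∈ Δ.rules X
  · exact (Δ.prob_mem X α h).1.le
  · exact (Δ.prob_eq_zero X α h).ge

theorem PBPA.code_injective {n : ℕ} : Function.Injective (PBPA.code (n := n)) := by
  intro Δ Δ' h
  have h := fun X => congrFun (List.ofFn_injective h) X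
  have hr : Δ.rules = Δ'.rules := by
    funext X
    have h1 := congrArg (List.map Prod.fst) (h X)
    simp only [List.map_map] at h1
    exact (List.map_injective_iff.2 (List.map_injective_iff.2 Fin.val_injective)) h1
  have hp : Δ.prob = Δ'.prob := by
    funext X α
    by_cases hα : α ∈ Δ.rules X
    · have h1 := h X
      rw [← hr] at h1
      have h2 := List.map_inj_left.1 h1 α hα
      simp only [Prod.mk.injEq, true_and] at h2
      exact rat_eq_of_code (Δ.prob_nonneg _ _) (Δ'.prob_nonneg _ _) h2.1 h2.2
    · rw [Δ.prob_eq_zero X α hα, Δ'.prob_eq_zero X α (hr ▸ hα)]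
  cases Δ; cases Δ'; cases hr; cases hp; rfl

theorem SimpleValuation.code_injective {n k : ℕ} :
    Function.Injective (SimpleValuation.code (n := n) (k := k)) := by
  intro H H' h
  have h := fun p => congrFun (List.ofFn_injective h) p
  funext p X
  have hp := h p
  simp only [Prod.mk.injEq] at hp
  cases X with
  | none => exact hp.1
  | some X => exact congrFun (List.ofFn_injective hp.2) X

theorem FinDFA.code_injective {n : ℕ} : Function.Injective (FinDFA.code (n := n)) := by
  rintro ⟨m, s, q, a⟩ ⟨m', s', q', a'⟩ h
  simp only [FinDFA.code, Prod.mk.injEq] at h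
  have hm : m = m' := by simpa using congrArg List.length h.2
  subst hm
  have h2 := fun x => congrFun (List.ofFn_injective h.2) x
  simp only [Prod.mk.injEq] at h2
  have hs : s = s' := by
    funext x y
    exact Fin.ext (congrFun (List.ofFn_injective (h2 x).2) y)
  have ha : a = a' := funext fun x => (h2 x).1
  have hq : q = q' := Fin.ext h.1
  rw [hs, ha, hq]

theorem RegularValuation.code_injective {n k : ℕ} :
    Function.Injective (RegularValuation.code (n := n) (k := k)) := by
  intro A A' h
  exact funext fun p => FinDFA.code_injective (congrFun (List.ofFn_injective h) p)

/-- Different instances have different inputs. -/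
theorem MCInstance.simpleCode_injective : Function.Injective MCInstance.simpleCode := by
  rintro ⟨n, k, Δ, Z, H, Φ⟩ ⟨n', k', Δ', Z', H', Φ'⟩ h
  simp only [MCInstance.simpleCode, Prod.mk.injEq] at h
  obtain ⟨h1, h2, h3, h4⟩ := h
  have hn : n = n' := by simpa [PBPA.code] using congrArg List.length h1
  have hk : k = k' := by simpa [SimpleValuation.code] using congrArg List.length h3
  subst hn hk
  rw [PBPA.code_injective h1, Fin.ext h2, SimpleValuation.code_injective h3,
    PCTL.code_injective h4]

/-- Different instances have different inputs. -/
theorem MCInstance.regularCode_injective : Function.Injective MCInstance.regularCode := by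
  rintro ⟨n, k, Δ, Z, A, Φ⟩ ⟨n', k', Δ', Z', A', Φ'⟩ h
  simp only [MCInstance.regularCode, Prod.mk.injEq] at h
  obtain ⟨h1, h2, h3, h4⟩ := h
  have hn : n = n' := by simpa [PBPA.code] using congrArg List.length h1
  have hk : k = k' := by simpa [RegularValuation.code] using congrArg List.length h3
  subst hn hk
  rw [PBPA.code_injective h1, Fin.ext h2, RegularValuation.code_injective h3,
    PCTL.code_injective h4]

/-! The halting problem is reduced to model checking. The rules, the valuation and the formula are
the same for all inputs; the input enters only through the probability `inputProb m` of one rule.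

A control symbol on top of the stack walks through a finite graph and leaves a mark below itself at
each step, so that the stack stores a guessed word of marks. When the stack is popped, a mark
decides at random between success, failure and going on. So it turns the probability `x` of success
below it into `(shift + slope * x) / branch` (`success_mark`). Different pairs of propositions give
different affine maps for the same mark, and a word has one value in each dimension. The formula
says that some reachable word has all values one half (`sat_formula_iff`); "some" is expressed by
positive probability (`runMeasure_untilSet_univ_pos_iff`).

The words describe histories of a machine with several stacks. Every proper step on a stack reads
its current version letter by letter and writes the next version. For each stack one dimension
collects the letters read, and another one the initial contents followed by the letters written, as
base-`8` expansions. The history is genuine iff the two words agree for every stack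
(`halts_of_path`, `exists_path_of_halts`), that is, iff the two numbers agree
(`digitValue_half_injective`).

PCTL compares probabilities with constants only, not with each other. Therefore a history ends with
guessed contractions that act alike on both dimensions of a stack. They are injective, so if both
results are one half, the numbers were equal before. Conversely, the numbers are dyadic, and every
dyadic number in the open unit interval can be moved to one half (`FixMove.exists_mapList_eq_half`).

The machine is obtained from a multi-stack Turing machine that evaluates all programs
(`exists_universal_stackMachine`). Simple valuations are special regular ones, so both problems are
undecidable. -/

namespace MarkovChain

/-! ### Sets of runs -/

section Sets

variable {S : Type}

/-- The runs whose first `k + 1` states are those of `p`. -/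
def prefixSet (k : ℕ) (p : ℕ → S) : Set (ℕ → S) := {ω | ∀ i ≤ k, ω i = p i}

theorem prefixSet_eq_preimage (k : ℕ) (p : ℕ → S) :
    prefixSet k p = Preorder.frestrictLe (π := fun _ => S) k ⁻¹' {Preorder.frestrictLe k p} := by
  ext ω
  simp only [prefixSet, Set.mem_ofPred_eq, Set.mem_preimage, Set.mem_singleton_iff, funext_iff,
    Subtype.forall, Finset.mem_Iic, Preorder.frestrictLe_apply]

/-- The sequence that starts with `s` and goes on with `ω`. -/
def consRun (s : S) (ω : ℕ → S) : ℕ → S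
  | 0 => s
  | n + 1 => ω n

/-- The runs that stay in `A` until they reach `B`. -/
def untilSet (A B : Set S) : Set (ℕ → S) := {ω | ∃ k, ω k ∈ B ∧ ∀ j < k, ω j ∈ A}

theorem consRun_mem_untilSet {A B : Set S} {s : S} {ω : ℕ → S} :
    consRun s ω ∈ untilSet A B ↔ s ∈ B ∨ s ∈ A ∧ ω ∈ untilSet A B := by
  constructor
  · rintro ⟨k, hk, hj⟩
    cases k with
    | zero => exact .inl hk
    | succ k => exact .inr ⟨hj 0 (by omega), k, hk, fun j hjk => hj (j + 1) (by omega)⟩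
  · rintro (h | ⟨h, k, hk, hj⟩)
    · exact ⟨0, h, by simp⟩
    · refine ⟨k + 1, hk, fun j hjk => ?_⟩
      cases j with
      | zero => exact h
      | succ j => exact hj j (by omega)

variable [MeasurableSpace S]

theorem measurable_consRun (s : S) : Measurable (consRun s) := by
  refine measurable_pi_lambda _ fun n => ?_
  cases n with
  | zero => exact measurable_const
  | succ n => exact measurable_pi_apply n

variable [DiscreteMeasurableSpace S]

theorem measurableSet_prefixSet (k : ℕ) (p : ℕ → S) : MeasurableSet (prefixSet k p) := by
  have : prefixSet k p = ⋂ i, ⋂ _ : i ≤ k, (fun ω : ℕ → S => ω i) ⁻¹' {p i} := by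
    ext ω; simp [prefixSet]
  rw [this]
  exact .iInter fun i => .iInter fun _ => measurable_pi_apply i (.of_discrete)

theorem measurableSet_untilSet (A B : Set S) : MeasurableSet (untilSet A B) := by
  have : untilSet A B = ⋃ k, ((fun ω : ℕ → S => ω k) ⁻¹' B ∩
      ⋂ j, ⋂ _ : j < k, (fun ω : ℕ → S => ω j) ⁻¹' A) := by
    ext ω; simp [untilSet]
  rw [this]
  exact .iUnion fun k => (measurable_pi_apply k .of_discrete).inter
    (.iInter fun j => .iInter fun _ => measurable_pi_apply j .of_discrete)

end Sets

/-! ### The law of the runs -/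

section Law

variable {S : Type} [MeasurableSpace S] [DiscreteMeasurableSpace S] [Countable S]

instance (M : MarkovChain S) (s : S) : IsProbabilityMeasure (M.runMeasure s) :=
  inferInstanceAs (IsProbabilityMeasure (Kernel.traj (X := fun _ => S) M.historyKernel 0 _))

/-- As `S` is countable, the law of an initial segment is determined by its atoms, whose preimages
are the prefix sets. Every cylinder depends on an initial segment only, and the cylinders form a
generating π-system. -/
theorem ext_of_prefixSet {μ ν : Measure (ℕ → S)} [IsProbabilityMeasure μ] [IsProbabilityMeasure ν]
    (h : ∀ k p, μ (prefixSet k p) = ν (prefixSet k p)) : μ = ν := by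
  have key : ∀ k, μ.map (Preorder.frestrictLe (π := fun _ => S) k) =
      ν.map (Preorder.frestrictLe (π := fun _ => S) k) := by
    intro k
    refine Measure.ext_of_singleton fun a => ?_
    rw [Measure.map_apply (by fun_prop) (measurableSet_singleton a),
      Measure.map_apply (by fun_prop) (measurableSet_singleton a)]
    have ha : a = Preorder.frestrictLe (π := fun _ => S) k
        (fun i => if hi : i ≤ k then a ⟨i, Finset.mem_Iic.2 hi⟩ else a ⟨0, by simp⟩) := by
      funext i
      have := Finset.mem_Iic.1 i.2
      simp [this]
    rw [ha, ← prefixSet_eq_preimage]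
    exact h _ _
  refine ext_of_generate_finite (measurableCylinders fun _ => S)
    generateFrom_measurableCylinders.symm isPiSystem_measurableCylinders (fun s hs => ?_) (by simp)
  obtain ⟨I, T, hT, rfl⟩ := (mem_measurableCylinders _).mp hs
  have e : cylinder I T = Preorder.frestrictLe (π := fun _ => S) (I.sup id) ⁻¹'
      (Finset.restrict₂ (π := fun _ => S) I.subset_Iic_sup_id ⁻¹' T) := rfl
  have hm : MeasurableSet (Finset.restrict₂ (π := fun _ => S) I.subset_Iic_sup_id ⁻¹' T) :=
    hT.preimage (by fun_prop)
  rw [e, ← Measure.map_apply (by fun_prop) hm, key, Measure.map_apply (by fun_prop) hm]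

open scoped Classical in
theorem runMeasure_prefixSet_zero (M : MarkovChain S) (s : S) (p : ℕ → S) :
    M.runMeasure s (prefixSet 0 p) = if s = p 0 then 1 else 0 := by
  rw [prefixSet_eq_preimage, ← Measure.map_apply (by fun_prop) (measurableSet_singleton _),
    runMeasure, Kernel.traj_map_frestrictLe_apply, Kernel.partialTraj_self, Kernel.id_apply,
    Measure.dirac_apply]
  have : ((fun _ => s) : (i : Finset.Iic 0) → S) = Preorder.frestrictLe (π := fun _ => S) 0 p ↔
      s = p 0 := by
    simp [funext_iff]
  simp only [Set.indicator, Set.mem_singleton_iff, this, Pi.one_apply]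

/-- The joint law of the history and the next state is a composition-product; this evaluates it on a
singleton times a singleton. -/
theorem runMeasure_prefixSet_succ (M : MarkovChain S) (s : S) (k : ℕ) (p : ℕ → S) :
    M.runMeasure s (prefixSet (k + 1) p) =
      M.runMeasure s (prefixSet k p) * M (p k) (p (k + 1)) := by
  have h := Kernel.partialTraj_compProd_eq_map_traj (X := fun _ => S) (κ := M.historyKernel)
    (Nat.zero_le k)
    (x₀ := fun _ => s)
  have h2 := congrArg (fun μ => μ ({Preorder.frestrictLe (π := fun _ => S) k p} ×ˢ {p (k + 1)})) h
  rw [Measure.compProd_apply_prod (measurableSet_singleton _) (measurableSet_singleton _),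
    Measure.map_apply (by fun_prop) ((measurableSet_singleton _).prod (measurableSet_singleton _)),
    ← Kernel.traj_map_frestrictLe_apply, lintegral_singleton,
    Measure.map_apply (by fun_prop) (measurableSet_singleton _), ← prefixSet_eq_preimage] at h2
  have e : (fun x : ℕ → S => (Preorder.frestrictLe (π := fun _ => S) k x, x (k + 1))) ⁻¹'
      ({Preorder.frestrictLe (π := fun _ => S) k p} ×ˢ {p (k + 1)}) = prefixSet (k + 1) p := by
    ext ω
    simp only [Set.mk_preimage_prod, Set.mem_inter_iff, ← prefixSet_eq_preimage]
    simp only [prefixSet, Set.mem_ofPred_eq, Set.mem_preimage, Set.mem_singleton_iff]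
    constructor
    · rintro ⟨h1, h2⟩ i hi
      rcases Nat.le_succ_iff.1 hi with hi | rfl
      exacts [h1 i hi, h2]
    · intro h1
      exact ⟨fun i hi => h1 i (by omega), h1 _ le_rfl⟩
  rw [e] at h2
  rw [runMeasure, ← h2, mul_comm]
  congr 1
  rw [← PMF.toMeasure_apply_singleton _ _ (measurableSet_singleton _)]
  rfl

/-- The first step of a run. -/
theorem runMeasure_eq_bind (M : MarkovChain S) (s : S) :
    M.runMeasure s =
      (M s).toMeasure.bind fun t => (M.runMeasure t).map (consRun s) := by
  have hmeas : Measurable fun t => (M.runMeasure t).map (consRun s) := .of_discrete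
  have : IsProbabilityMeasure ((M s).toMeasure.bind fun t => (M.runMeasure t).map (consRun s)) := by
    constructor
    rw [Measure.bind_apply .univ hmeas.aemeasurable]
    have : ∀ t, (M.runMeasure t).map (consRun s) Set.univ = 1 := fun t => by
      rw [Measure.map_apply (measurable_consRun s) .univ]; simp
    simp [this]
  refine ext_of_prefixSet fun k p => ?_
  rw [Measure.bind_apply (measurableSet_prefixSet _ _) hmeas.aemeasurable]
  classical
  simp only [Measure.map_apply (measurable_consRun s) (measurableSet_prefixSet _ _)]
  cases k with
  | zero =>
    have : consRun s ⁻¹' prefixSet 0 p = if s = p 0 then Set.univ else ∅ := by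
      split_ifs with h <;> (ext ω; simp [prefixSet, consRun, h])
    rw [runMeasure_prefixSet_zero, this]
    split_ifs <;> simp
  | succ k =>
    have e : consRun s ⁻¹' prefixSet (k + 1) p =
        if s = p 0 then prefixSet k (fun i => p (i + 1)) else ∅ := by
      split_ifs with h
      · ext ω
        simp only [prefixSet, Set.mem_preimage, Set.mem_ofPred_eq]
        constructor
        · intro h1 i hi
          exact h1 (i + 1) (by omega)
        · intro h1 i hi
          cases i with
          | zero => exact h
          | succ i => exact h1 i (by omega)
      · ext ω
        simp only [prefixSet, Set.mem_preimage, Set.mem_ofPred_eq, Set.mem_empty_iff_false,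
          iff_false]
        exact fun h1 => h (h1 0 (by omega))
    rw [e]
    split_ifs with h
    · subst h
      -- Lengthening the prefix by one state multiplies both sides by the same transition
      -- probability.
      have : ∀ k, M.runMeasure (p 0) (prefixSet (k + 1) p) =
          ∫⁻ t, M.runMeasure t (prefixSet k fun i => p (i + 1)) ∂(M (p 0)).toMeasure := by
        intro k
        induction k with
        | zero =>
          rw [runMeasure_prefixSet_succ, runMeasure_prefixSet_zero]
          simp only [runMeasure_prefixSet_zero, if_true, one_mul, zero_add]
          have : (fun t => if t = p 1 then (1 : ℝ≥0∞) else 0) = Set.indicator {p 1} 1 := by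
            ext t; simp [Set.indicator]
          rw [this, lintegral_indicator_one (measurableSet_singleton _),
            PMF.toMeasure_apply_singleton _ _ (measurableSet_singleton _)]
        | succ k ih =>
          rw [runMeasure_prefixSet_succ, ih]
          simp only [fun t => runMeasure_prefixSet_succ M t k]
          rw [lintegral_mul_const _ .of_discrete]
      exact this k
    · have : ∀ k, M.runMeasure s (prefixSet k p) = 0 := by
        intro k
        induction k with
        | zero => rw [runMeasure_prefixSet_zero, if_neg h]
        | succ k ih => rw [runMeasure_prefixSet_succ, ih, zero_mul]
      simp [this]

theorem runMeasure_apply_eq_lintegral (M : MarkovChain S) (s : S) {E : Set (ℕ → S)}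
    (hE : MeasurableSet E) :
    M.runMeasure s E = ∫⁻ t, M.runMeasure t (consRun s ⁻¹' E) ∂(M s).toMeasure := by
  conv_lhs => rw [runMeasure_eq_bind]
  rw [Measure.bind_apply hE Measurable.of_discrete.aemeasurable]
  simp only [Measure.map_apply (measurable_consRun s) hE]

/-! ### Until -/

variable (M : MarkovChain S) {A B : Set S} {s : S}

theorem runMeasure_untilSet_of_mem (h : s ∈ B) : M.runMeasure s (untilSet A B) = 1 := by
  rw [runMeasure_apply_eq_lintegral _ _ (measurableSet_untilSet _ _)]
  have : consRun s ⁻¹' untilSet A B = Set.univ := by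
    ext ω; simp [consRun_mem_untilSet, h]
  simp [this]

theorem runMeasure_untilSet_of_notMem (hB : s ∉ B) (hA : s ∉ A) :
    M.runMeasure s (untilSet A B) = 0 := by
  rw [runMeasure_apply_eq_lintegral _ _ (measurableSet_untilSet _ _)]
  have : consRun s ⁻¹' untilSet A B = ∅ := by
    ext ω; simp [consRun_mem_untilSet, hA, hB]
  simp [this]

theorem runMeasure_untilSet_step (hB : s ∉ B) (hA : s ∈ A) :
    M.runMeasure s (untilSet A B) =
      ∫⁻ t, M.runMeasure t (untilSet A B) ∂(M s).toMeasure := by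
  rw [runMeasure_apply_eq_lintegral _ _ (measurableSet_untilSet _ _)]
  have : consRun s ⁻¹' untilSet A B = untilSet A B := by
    ext ω; simp [consRun_mem_untilSet, hA, hB]
  simp [this]

/-- A state is reachable if some finite path of positive probability leads to it. -/
theorem runMeasure_untilSet_univ_pos_iff :
    0 < M.runMeasure s (untilSet Set.univ B) ↔
      ∃ t ∈ B, Relation.ReflTransGen (fun a b => b ∈ (M a).support) s t := by
  constructor
  · contrapose!
    intro h
    -- For each fixed time: almost every first step leads to a state from which `B` is still
    -- unreachable.
    have h0 : ∀ k s, (∀ t ∈ B, ¬ Relation.ReflTransGen (fun a b => b ∈ (M a).support) s t) →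
        M.runMeasure s {ω | ω k ∈ B} = 0 := by
      intro k
      induction k with
      | zero =>
        intro s hs
        rw [runMeasure_apply_eq_lintegral M s
          (E := {ω | ω 0 ∈ B}) (measurable_pi_apply 0 (.of_discrete (s := B)))]
        have : consRun s ⁻¹' {ω | ω 0 ∈ B} = ∅ := by
          ext ω
          simp only [Set.mem_preimage, Set.mem_ofPred_eq, consRun, Set.mem_empty_iff_false, iff_false]
          exact fun hB => hs s hB .refl
        simp [this]
      | succ k ih =>
        intro s hs
        rw [runMeasure_apply_eq_lintegral M s
          (E := {ω | ω (k + 1) ∈ B}) (measurable_pi_apply (k + 1) (.of_discrete (s := B)))]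
        rw [lintegral_eq_zero_iff .of_discrete]
        have hsupp : ∀ᵐ t ∂(M s).toMeasure, t ∈ (M s).support := by
          rw [ae_iff]
          have := (M s).toMeasure_apply_eq_zero_iff
            (s := {t | t ∉ (M s).support}) .of_discrete
          rw [this, Set.disjoint_left]
          simp
        filter_upwards [hsupp] with t ht
        exact ih t fun u hu hr => hs u hu (.head ht hr)
    have : untilSet Set.univ B = ⋃ k, {ω : ℕ → S | ω k ∈ B} := by
      ext ω; simp [untilSet]
    rw [this]
    exact le_of_eq (measure_iUnion_null fun k => h0 k s h)
  · rintro ⟨t, ht, hr⟩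
    induction hr using Relation.ReflTransGen.head_induction_on with
    | refl => rw [runMeasure_untilSet_of_mem _ ht]; simp
    | @head a b hab _ ih =>
      by_cases ha : a ∈ B
      · rw [runMeasure_untilSet_of_mem _ ha]; simp
      rw [runMeasure_untilSet_step _ ha (Set.mem_univ a)]
      refine pos_iff_ne_zero.2 fun h0 => ?_
      rw [lintegral_eq_zero_iff .of_discrete] at h0
      -- A vanishing integral would put `b`, where the integrand is positive, into a null set.
      have h1 : (M a).toMeasure {b} = 0 := by
        refine measure_mono_null ?_ (ae_iff.1 h0)
        intro x hx
        rw [Set.mem_singleton_iff.1 hx]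
        exact ih.ne'
      rw [PMF.toMeasure_apply_singleton _ _ (measurableSet_singleton _)] at h1
      exact hab h1

end Law

end MarkovChain

/-! ### Affine contractions of the unit interval -/

/-- The contractions `x ↦ (x + d) / 3` and `x ↦ (2 x + d) / 3` of the unit interval. -/
inductive FixMove
  | third (d : Fin 3)
  | twoThirds (d : Fin 2)
  deriving DecidableEq, Fintype

namespace FixMove

/-- The constant term of a contraction, in thirds. -/
def shift : FixMove → ℕ
  | third d => d
  | twoThirds d => d

/-- The slope of a contraction, in thirds. -/
def slope : FixMove → ℕ
  | third _ => 1
  | twoThirds _ => 2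

theorem shift_add_slope_le (f : FixMove) : f.shift + f.slope ≤ 3 := by
  cases f <;> simp only [shift, slope] <;> omega

/-- The contraction as a function. -/
noncomputable def map (f : FixMove) (x : ℝ) : ℝ := (f.shift + f.slope * x) / 3

theorem map_injective (f : FixMove) : Function.Injective f.map := by
  intro x y h
  cases f <;> simp only [map, shift, slope] at h <;> push_cast at h <;> linarith

/-- The composition of a list of contractions, the first one being applied first. -/
noncomputable def mapList (w : List FixMove) (x : ℝ) : ℝ := w.foldl (fun x f => f.map x) x

/-- All slopes are nonzero. This makes equal results of the same contractions a proof that the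
arguments were equal. -/
theorem mapList_injective (w : List FixMove) : Function.Injective (mapList w) := by
  induction w with
  | nil => exact fun x y h => h
  | cons f w ih => exact fun x y h => f.map_injective (ih h)

/-- Every dyadic number strictly between `0` and `1` can be moved to `1 / 2`. -/
theorem exists_mapList_eq_half (k : ℕ) : ∀ m : ℤ, Odd m → 0 < m → m < 2 ^ (k + 1) →
    ∃ w, mapList w (m / 2 ^ (k + 1)) = 1 / 2 := by
  induction k with
  | zero =>
    intro m _ h0 h1
    obtain rfl : m = 1 := by norm_num at h1; omega
    exact ⟨[], by simp [mapList]⟩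
  | succ k ih =>
    -- The outer induction lowers the exponent of the denominator, the inner one the distance of the
    -- numerator from `2 ^ (k + 1)`, that is, of the number from `1 / 2`.
    suffices H : ∀ (b : ℕ) (m : ℤ), (m - 2 ^ (k + 1)).natAbs ≤ b → Odd m → 0 < m →
        m < 2 ^ (k + 2) → ∃ w, mapList w (m / 2 ^ (k + 2)) = 1 / 2 from
      fun m => H _ m le_rfl
    have hp : (0 : ℤ) < 2 ^ (k + 1) := by positivity
    have hpp : (2 : ℤ) ^ (k + 2) = 2 * 2 ^ (k + 1) := by ring
    have hev : Even ((2 : ℤ) ^ (k + 1)) := by simp [Int.even_pow]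
    have hmod : ¬ (3 : ℤ) ∣ 2 ^ (k + 1) := by
      intro h
      have := Int.prime_three.dvd_of_dvd_pow h
      norm_num at this
    have hR : (2 : ℝ) ^ (k + 2) = 2 * 2 ^ (k + 1) := by ring
    intro b
    induction b with
    | zero =>
      intro m hm hodd
      have : m = 2 ^ (k + 1) := by omega
      rw [this] at hodd
      exact absurd hev (Int.not_even_iff_odd.2 hodd)
    | succ b ihb =>
      intro m hm hodd h0 h1
      have hne : m ≠ 2 ^ (k + 1) := by
        rintro rfl
        exact absurd hev (Int.not_even_iff_odd.2 hodd)
      rw [hpp] at h1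
      -- As `3` does not divide `2 ^ (k + 1)`, these cases exhaust the residues of `m`. In each of
      -- them one contraction lets the factor `3` cancel.
      obtain ⟨t, ht⟩ | ⟨t, ht⟩ | ⟨t, ht⟩ :
          (3 : ℤ) ∣ m - 2 ^ (k + 1) ∨ (3 : ℤ) ∣ m ∨ (3 : ℤ) ∣ m + 2 ^ (k + 1) := by
        have h3 : m % 3 = 0 ∨ m % 3 = 1 ∨ m % 3 = 2 := by omega
        have h4 : (2 : ℤ) ^ (k + 1) % 3 = 1 ∨ (2 : ℤ) ^ (k + 1) % 3 = 2 := by omega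
        rcases h3 with h3 | h3 | h3 <;> rcases h4 with h4 | h4 <;> omega
      -- The map `x ↦ (x + 1) / 3` fixes `1 / 2` and divides the distance from it by three; the
      -- denominator stays.
      · have hm' : m = 3 * t + 2 ^ (k + 1) := by omega
        obtain ⟨w, hw⟩ := ihb (t + 2 ^ (k + 1)) (by omega) (by
          rw [Int.odd_iff] at hodd ⊢; rw [Int.even_iff] at hev; omega) (by omega) (by omega)
        refine ⟨third 1 :: w, ?_⟩
        rw [← hw]
        simp only [mapList, List.foldl_cons]
        congr 1
        rw [hm', map, hR]
        have hd : ((1 : Fin 3) : ℕ) = 1 := rfl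
        simp only [shift, slope, hd]
        push_cast
        field_simp
        ring
      -- The map `x ↦ 2 * x / 3` halves the denominator.
      · obtain ⟨w, hw⟩ := ih t (by
          rw [Int.odd_iff] at hodd ⊢; omega) (by omega) (by omega)
        refine ⟨twoThirds 0 :: w, ?_⟩
        rw [← hw]
        simp only [mapList, List.foldl_cons]
        congr 1
        rw [ht, map, hR]
        simp only [shift, slope, Fin.val_zero]
        push_cast
        field_simp
        ring
      -- The mirror image of the previous case under `x ↦ 1 - x`; again the denominator is halved.
      · have hm' : m = 3 * t - 2 ^ (k + 1) := by omega
        obtain ⟨w, hw⟩ := ih t (by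
          rw [Int.odd_iff] at hodd ⊢; rw [Int.even_iff] at hev; omega) (by omega) (by omega)
        refine ⟨twoThirds 1 :: w, ?_⟩
        rw [← hw]
        simp only [mapList, List.foldl_cons]
        congr 1
        rw [hm', map, hR]
        simp only [shift, slope, Fin.val_one]
        push_cast
        field_simp
        ring

end FixMove

/-! ### Words as dyadic numbers -/

/-- The number with the base-`8` digits `l`, the last one being the most significant,
followed by the expansion of `x`. -/
noncomputable def digitValue (x : ℝ) (l : List (Fin 8)) : ℝ :=
  l.foldl (fun x (c : Fin 8) => ((c : ℕ) + x) / 8) x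

theorem digitValue_append (x : ℝ) (l l' : List (Fin 8)) :
    digitValue x (l ++ l') = digitValue (digitValue x l) l' := by
  simp only [digitValue, List.foldl_append]

theorem digitValue_concat (x : ℝ) (l : List (Fin 8)) (c : Fin 8) :
    digitValue x (l ++ [c]) = ((c : ℕ) + digitValue x l) / 8 := by
  rw [digitValue_append]; rfl

/-- A digit puts three binary places in front. The final binary digit `1`, which comes from `1 / 2`,
stays last, so the numerator stays odd. -/
theorem digitValue_half_eq_dyadic (l : List (Fin 8)) :
    ∃ (k : ℕ) (m : ℤ), Odd m ∧ 0 < m ∧ m < 2 ^ (k + 1) ∧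
      digitValue (1 / 2) l = m / 2 ^ (k + 1) := by
  induction l using List.reverseRecOn with
  | nil => exact ⟨0, 1, odd_one, by simp, by simp, by simp [digitValue]⟩
  | append_singleton l c ih =>
    obtain ⟨k, m, hodd, h0, h1, he⟩ := ih
    have hp : (0 : ℤ) < 2 ^ (k + 1) := by positivity
    have hc : ((c : ℕ) : ℤ) ≤ 7 := by omega
    refine ⟨k + 3, (c : ℕ) * 2 ^ (k + 1) + m, ?_, by positivity, ?_, ?_⟩
    · refine Even.add_odd (Even.mul_left ?_ _) hodd
      simp [Int.even_pow]
    · have : (2 : ℤ) ^ (k + 3 + 1) = 8 * 2 ^ (k + 1) := by ring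
      nlinarith
    · rw [digitValue_concat, he]
      push_cast
      have : (2 : ℝ) ^ (k + 3 + 1) = 8 * 2 ^ (k + 1) := by ring
      rw [this]
      field_simp

theorem digitValue_half_mem_Ioo (l : List (Fin 8)) :
    digitValue (1 / 2) l ∈ Set.Ioo (0 : ℝ) 1 := by
  obtain ⟨k, m, -, h0, h1, he⟩ := digitValue_half_eq_dyadic l
  rw [he]
  have h0' : (0 : ℝ) < m := by exact_mod_cast h0
  have h1' : (m : ℝ) < 2 ^ (k + 1) := by exact_mod_cast h1
  exact ⟨by positivity, by rw [div_lt_one (by positivity)]; exact h1'⟩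

/-- Otherwise the value of `l` would be `4 - c`, an integer strictly between `0` and `1`. -/
theorem digitValue_concat_ne_half (l : List (Fin 8)) (c : Fin 8) :
    digitValue (1 / 2) (l ++ [c]) ≠ 1 / 2 := by
  rw [digitValue_concat]
  obtain ⟨h0, h1⟩ := digitValue_half_mem_Ioo l
  intro h
  have h4 : digitValue (1 / 2) l = ((4 - (c : ℕ) : ℤ) : ℝ) := by push_cast; linarith
  rw [h4] at h0 h1
  have h0' : (0 : ℤ) < 4 - (c : ℕ) := by exact_mod_cast h0
  have h1' : (4 - (c : ℕ) : ℤ) < 1 := by exact_mod_cast h1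
  omega

/-- The last digit is the integer part of eight times the value, since what remains lies strictly
between `0` and `1`. The starting value `1 / 2` marks the end of the expansion, so no digit `0` gets
lost. -/
theorem digitValue_half_injective : Function.Injective (digitValue (1 / 2)) := by
  intro l
  induction l using List.reverseRecOn with
  | nil =>
    intro l' h
    rcases List.eq_nil_or_concat l' with rfl | ⟨l', c, rfl⟩
    · rfl
    · rw [List.concat_eq_append] at h
      exact absurd h.symm (digitValue_concat_ne_half l' c)
  | append_singleton l c ih =>
    intro l' h
    rcases List.eq_nil_or_concat l' with rfl | ⟨l', c', rfl⟩
    · exact absurd h (digitValue_concat_ne_half l c)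
    · rw [List.concat_eq_append] at h ⊢
      rw [digitValue_concat, digitValue_concat] at h
      obtain ⟨h0, h1⟩ := digitValue_half_mem_Ioo l
      obtain ⟨h0', h1'⟩ := digitValue_half_mem_Ioo l'
      have a1 : ((c : ℕ) : ℝ) < (c' : ℕ) + 1 := by linarith
      have a2 : ((c' : ℕ) : ℝ) < (c : ℕ) + 1 := by linarith
      have a1' : (c : ℕ) < (c' : ℕ) + 1 := by exact_mod_cast a1
      have a2' : (c' : ℕ) < (c : ℕ) + 1 := by exact_mod_cast a2
      have hc : c = c' := Fin.ext (by omega)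
      subst hc
      have hl : digitValue (1 / 2) l = digitValue (1 / 2) l' := by linarith
      rw [ih hl]

/-! ### Affine automata -/

/-- A finite control graph whose edges carry marks. A mark acts on the unit interval, for every
dimension in `J`, as the affine map `x ↦ (shift + slope * x) / branch`. -/
structure AffineAutomaton (Q S J : Type) where
  branch : ℕ
  branch_pos : 0 < branch
  edge : Q → S → Q → Prop
  start : Q
  final : Q
  final_edge : ∀ s q, ¬ edge final s q
  shift : J → S → ℕ
  slope : J → S → ℕ
  le_branch : ∀ j s, shift j s + slope j s ≤ branch
  base : J

namespace AffineAutomaton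

variable {Q S J : Type} (A : AffineAutomaton Q S J)

/-- The words of marks along the paths of the control graph. -/
inductive Path : Q → List S → Q → Prop
  | nil (q : Q) : Path q [] q
  | cons {q q' q'' : Q} {s : S} {h : List S} (e : A.edge q s q') (p : Path q' h q'') :
      Path q (s :: h) q''

variable {A} in
theorem Path.append {q q' q'' : Q} {h h' : List S} (p : A.Path q h q') (r : A.Path q' h' q'') :
    A.Path q (h ++ h') q'' := by
  induction p with
  | nil => exact r
  | cons e _ ih => exact .cons e (ih r)

/-- The action of a mark. -/
noncomputable def act (j : J) (s : S) (x : ℝ) : ℝ := (A.shift j s + A.slope j s * x) / A.branch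

open scoped Classical in
/-- The value of a word of marks: it starts at `v` in the dimension `base`, and at `0` in the
other ones. -/
noncomputable def value (v : ℚ) (j : J) (h : List S) : ℝ :=
  h.foldl (fun x s => A.act j s x) (if j = A.base then (v : ℝ) else 0)

end AffineAutomaton

/-! ### The pushdown process of an affine automaton -/

/-- The stack symbols of the process of an affine automaton. -/
inductive StackSym (Q S : Type) (N : ℕ)
  | start
  | bot
  | botYes
  | botNo
  | ctl (q : Q)
  | mark (s : S)
  | out (s : S) (i : Fin N)
  deriving Fintype

namespace AffineAutomaton

variable {Q S J : Type} [Fintype Q] [Fintype S] (A : AffineAutomaton Q S J)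

/-- The stack symbols of the process of `A`. -/
abbrev Sym := StackSym Q S A.branch

/-- The numbering of the stack symbols. -/
noncomputable def symEquiv : A.Sym ≃ Fin (Fintype.card A.Sym) := Fintype.equivFin _

open scoped Classical in
/-- The edges that leave a control state. -/
noncomputable def edges (q : Q) : Finset (S × Q) :=
  Finset.univ.filter fun e => A.edge q e.1 e.2

open scoped Classical in
/-- The right-hand sides of the rules. The control state walks along the edges and
leaves their marks below it; a control state without edges is popped. A mark is replaced by one
of its outcomes, which is popped. -/
noncomputable def rhs : A.Sym → Finset (List A.Sym)
  | .start => {[.ctl A.start, .bot]}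
  | .bot => {[.botYes], [.botNo]}
  | .botYes => {[]}
  | .botNo => {[]}
  | .ctl q => if A.edges q = ∅ then {[]} else (A.edges q).image fun e => [.ctl e.2, .mark e.1]
  | .mark s => Finset.univ.image fun i => [.out s i]
  | .out _ _ => {[]}

theorem rhs_nonempty (x : A.Sym) : (A.rhs x).Nonempty := by
  classical
  cases x with
  | ctl q =>
    rw [rhs]
    split_ifs with h
    · simp
    · exact (Finset.nonempty_iff_ne_empty.2 h).image _
  | mark s =>
    have : Nonempty (Fin A.branch) := ⟨⟨0, A.branch_pos⟩⟩
    exact Finset.univ_nonempty.image _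
  | _ => simp [rhs]

theorem length_le_of_mem_rhs {x : A.Sym} {α : List A.Sym} (h : α ∈ A.rhs x) : α.length ≤ 2 := by
  classical
  cases x with
  | ctl q =>
    rw [rhs] at h
    split_ifs at h with h'
    · simp_all
    · obtain ⟨e, -, rfl⟩ := Finset.mem_image.1 h
      simp
  | mark s =>
    obtain ⟨e, -, rfl⟩ := Finset.mem_image.1 h
    simp
  | bot =>
    simp only [rhs, Finset.mem_insert, Finset.mem_singleton] at h
    rcases h with rfl | rfl <;> simp
  | _ => simp_all [rhs]

/-- The probabilities of the rules: `bot` answers yes with probability `v`, and all other choices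
are uniform. -/
noncomputable def weight (v : ℚ) (x : A.Sym) (α : List A.Sym) : ℚ :=
  open scoped Classical in
  if α ∈ A.rhs x then
    if x = .bot then if α = [.botYes] then v else 1 - v
    else ((A.rhs x).card : ℚ)⁻¹
  else 0

variable {v : ℚ}

theorem weight_mem (hv : v ∈ Set.Ioo 0 1) {x : A.Sym} {α : List A.Sym} (h : α ∈ A.rhs x) :
    0 < A.weight v x α ∧ A.weight v x α ≤ 1 := by
  obtain ⟨h0, h1⟩ := hv
  rw [weight, if_pos h]
  split_ifs
  · exact ⟨h0, h1.le⟩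
  · exact ⟨by linarith, by linarith⟩
  · have hc : 1 ≤ (A.rhs x).card := Finset.card_pos.2 ⟨α, h⟩
    have hc' : (1 : ℚ) ≤ (A.rhs x).card := by exact_mod_cast hc
    exact ⟨by positivity, inv_le_one_of_one_le₀ hc'⟩

theorem sum_weight (x : A.Sym) : ∑ α ∈ A.rhs x, A.weight v x α = 1 := by
  classical
  by_cases hx : x = .bot
  · subst hx
    simp [rhs, weight]
  · rw [Finset.sum_congr rfl fun α hα => by rw [weight, if_pos hα, if_neg hx], Finset.sum_const,
      nsmul_eq_mul, mul_inv_cancel₀]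
    exact_mod_cast (Finset.card_pos.2 (A.rhs_nonempty x)).ne'

theorem toFinset_map_toList (s : Finset (List A.Sym)) :
    (s.toList.map (List.map A.symEquiv)).toFinset = s.image (List.map A.symEquiv) := by
  ext; simp

/-- The process of `A`. -/
noncomputable def process (v : ℚ) (hv : v ∈ Set.Ioo 0 1) : PBPA (Fintype.card A.Sym) where
  rules X := (A.rhs (A.symEquiv.symm X)).toList.map (List.map A.symEquiv)
  prob X α := A.weight v (A.symEquiv.symm X) (α.map A.symEquiv.symm)
  nodup X := (Finset.nodup_toList _).map (List.map_injective_iff.2 A.symEquiv.injective)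
  exists_rule X := by
    obtain ⟨α, hα⟩ := A.rhs_nonempty (A.symEquiv.symm X)
    exact ⟨_, List.mem_map_of_mem (Finset.mem_toList.2 hα)⟩
  length_le X α hα := by
    obtain ⟨β, hβ, rfl⟩ := List.mem_map.1 hα
    rw [List.length_map]
    exact A.length_le_of_mem_rhs (Finset.mem_toList.1 hβ)
  prob_mem X α hα := by
    obtain ⟨β, hβ, rfl⟩ := List.mem_map.1 hα
    simpa using A.weight_mem hv (Finset.mem_toList.1 hβ)
  prob_eq_zero X α hα := by
    rw [weight, if_neg]
    intro h
    exact hα (List.mem_map.2 ⟨_, Finset.mem_toList.2 h, by simp⟩)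
  sum_prob X := by
    rw [← A.sum_weight (v := v) (A.symEquiv.symm X), A.toFinset_map_toList,
      Finset.sum_image ((List.map_injective_iff.2 A.symEquiv.injective).injOn)]
    simp

variable (v) (hv : v ∈ Set.Ioo 0 1)

theorem toFinset_rules_process (x : A.Sym) :
    ((A.process v hv).rules (A.symEquiv x)).toFinset =
      (A.rhs x).image (List.map A.symEquiv) := by
  simp [process, toFinset_map_toList]

theorem lintegral_chain_cons (x : A.Sym) (β : List A.Sym)
    (g : Config (Fintype.card A.Sym) → ℝ≥0∞) :
    ∫⁻ t, g t ∂((A.process v hv).chain (A.symEquiv x :: β.map A.symEquiv)).toMeasure =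
      ∑ α ∈ A.rhs x, ENNReal.ofReal (A.weight v x α) * g ((α ++ β).map A.symEquiv) := by
  rw [PBPA.chain, ← PMF.toMeasure_map _ _ .of_discrete, lintegral_map .of_discrete .of_discrete,
    lintegral_countable']
  simp only [PMF.toMeasure_apply_singleton _ _ (measurableSet_singleton _)]
  rw [tsum_eq_sum (s := ((A.process v hv).rules (A.symEquiv x)).toFinset)]
  · rw [toFinset_rules_process,
      Finset.sum_image ((List.map_injective_iff.2 A.symEquiv.injective).injOn)]
    refine Finset.sum_congr rfl fun α _ => ?_
    rw [mul_comm, List.map_append]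
    congr 1
    simp [PBPA.ruleDist, process]
  · intro α hα
    have : (A.process v hv).ruleDist (A.symEquiv x) α = 0 := by
      rw [PBPA.ruleDist, PMF.ofFinset_apply_of_notMem _ _ hα]
    rw [this, mul_zero]

/-- One move of the process. -/
def Move : List A.Sym → List A.Sym → Prop
  | [], γ => γ = []
  | x :: β, γ => ∃ α ∈ A.rhs x, γ = α ++ β

/-- Because `0 < v < 1`, every rule has positive weight. Hence reachability is a matter of `Move`,
which does not involve `v`. -/
theorem mem_support_chain {β : List A.Sym} {t : Config (Fintype.card A.Sym)} :
    t ∈ ((A.process v hv).chain (β.map A.symEquiv)).support ↔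
      ∃ γ, A.Move β γ ∧ t = γ.map A.symEquiv := by
  cases β with
  | nil => simp [PBPA.chain, Move]
  | cons x β =>
    simp only [List.map_cons, PBPA.chain, PMF.mem_support_map_iff, Move]
    constructor
    · rintro ⟨α', hα', rfl⟩
      rw [PBPA.ruleDist, PMF.mem_support_ofFinset_iff, toFinset_rules_process] at hα'
      obtain ⟨α, hα, rfl⟩ := Finset.mem_image.1 hα'.1
      exact ⟨α ++ β, ⟨α, hα, rfl⟩, by simp⟩
    · rintro ⟨γ, ⟨α, hα, rfl⟩, rfl⟩
      refine ⟨α.map A.symEquiv, ?_, by simp⟩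
      rw [PBPA.ruleDist, PMF.mem_support_ofFinset_iff, toFinset_rules_process]
      refine ⟨Finset.mem_image_of_mem _ hα, ?_⟩
      have := (A.weight_mem hv hα).1
      simpa [process] using this

theorem reflTransGen_support_chain {β : List A.Sym} {t : Config (Fintype.card A.Sym)} :
    Relation.ReflTransGen (fun a b => b ∈ ((A.process v hv).chain a).support)
      (β.map A.symEquiv) t ↔ ∃ γ, Relation.ReflTransGen A.Move β γ ∧ t = γ.map A.symEquiv := by
  constructor
  · intro h
    induction h with
    | refl => exact ⟨β, .refl, rfl⟩
    | tail _ h ih =>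
      obtain ⟨γ, hγ, rfl⟩ := ih
      obtain ⟨γ', hγ', rfl⟩ := (A.mem_support_chain v hv).1 h
      exact ⟨γ', .tail hγ hγ', rfl⟩
  · rintro ⟨γ, h, rfl⟩
    exact Relation.ReflTransGen.lift _ (fun a b hab => (A.mem_support_chain v hv).2 ⟨b, hab, rfl⟩) _ _ h

end AffineAutomaton

/-! ### Stacks that store words of marks -/

namespace AffineAutomaton

section Stack

variable {Q S J : Type} (A : AffineAutomaton Q S J)

/-- The stack below the control state after a word of marks. -/
def stack (h : List S) : List A.Sym := (h.map .mark).reverse ++ [.bot]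

/-- Symbols that belong neither to the start nor to the control graph. -/
def Passive : A.Sym → Prop
  | .start => False
  | .ctl _ => False
  | _ => True

theorem passive_of_mem_stack (h : List S) : ∀ x ∈ A.stack h, A.Passive x := by
  intro x hx
  simp only [stack, List.mem_append, List.mem_reverse, List.mem_map, List.mem_singleton] at hx
  rcases hx with ⟨s, -, rfl⟩ | rfl <;> trivial

end Stack

variable {Q S J : Type} [Fintype Q] [Fintype S] (A : AffineAutomaton Q S J)

/-! ### The propositions and the formula -/

/-- The truth of the propositions by the top symbol: `none` marks the final control
state, and `some (j, true)` and `some (j, false)` mark success and failure in dimension `j`. -/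
def Label : Option (J × Bool) → A.Sym → Prop
  | none, x => x = .ctl A.final
  | some (j, true), .botYes => j = A.base
  | some (j, true), .out s i => i < A.shift j s
  | some (j, false), .out s i => A.shift j s + A.slope j s ≤ i
  | some _, _ => False

/-- The configurations where a proposition holds. -/
def labelSet (p : Option (J × Bool)) : Set (Config (Fintype.card A.Sym)) :=
  {w | ∃ x ∈ w.head?, A.Label p (A.symEquiv.symm x)}

theorem nil_notMem_labelSet (p : Option (J × Bool)) : [] ∉ A.labelSet p := by
  simp [labelSet]

theorem map_cons_mem_labelSet (p : Option (J × Bool)) (x : A.Sym) (β : List A.Sym) :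
    (x :: β).map A.symEquiv ∈ A.labelSet p ↔ A.Label p x := by
  simp [labelSet]

/-! ### Probabilities of success -/

section Success

variable (v : ℚ) (hv : v ∈ Set.Ioo 0 1) (j : J)

/-- The runs that succeed in dimension `j`. -/
def successSet : Set (ℕ → Config (Fintype.card A.Sym)) :=
  MarkovChain.untilSet (A.labelSet (some (j, false)))ᶜ (A.labelSet (some (j, true)))

/-- The probability of success in dimension `j`. -/
noncomputable def success (β : List A.Sym) : ℝ :=
  ((A.process v hv).chain.runMeasure (β.map A.symEquiv)).real (A.successSet j)

theorem success_of_label {x : A.Sym} (β : List A.Sym) (h : A.Label (some (j, true)) x) :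
    A.success v hv j (x :: β) = 1 := by
  rw [success, measureReal_def, successSet, MarkovChain.runMeasure_untilSet_of_mem]
  · simp
  · exact (A.map_cons_mem_labelSet _ _ _).2 h

theorem success_of_fail {x : A.Sym} (β : List A.Sym) (h : ¬ A.Label (some (j, true)) x)
    (h' : A.Label (some (j, false)) x) : A.success v hv j (x :: β) = 0 := by
  rw [success, measureReal_def, successSet, MarkovChain.runMeasure_untilSet_of_notMem]
  · simp
  · rwa [A.map_cons_mem_labelSet]
  · rwa [Set.mem_compl_iff, not_not, A.map_cons_mem_labelSet]

theorem success_cons {x : A.Sym} (β : List A.Sym) (h : ¬ A.Label (some (j, true)) x)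
    (h' : ¬ A.Label (some (j, false)) x) :
    A.success v hv j (x :: β) = ∑ α ∈ A.rhs x, (A.weight v x α : ℝ) * A.success v hv j (α ++ β) := by
  rw [success, measureReal_def, successSet, MarkovChain.runMeasure_untilSet_step]
  · rw [List.map_cons, A.lintegral_chain_cons, ENNReal.toReal_sum]
    · refine Finset.sum_congr rfl fun α hα => ?_
      rw [ENNReal.toReal_mul, ENNReal.toReal_ofReal]
      · rfl
      · exact_mod_cast (A.weight_mem hv hα).1.le
    · exact fun α _ => ENNReal.mul_ne_top ENNReal.ofReal_ne_top (measure_ne_top _ _)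
  · rwa [A.map_cons_mem_labelSet]
  · rwa [Set.mem_compl_iff, A.map_cons_mem_labelSet]

/-- The empty stack is absorbing and carries no label, so no success can be reached from it. -/
theorem success_nil : A.success v hv j [] = 0 := by
  have h : A.successSet j ⊆
      MarkovChain.untilSet Set.univ (A.labelSet (some (j, true))) := by
    rintro ω ⟨k, hk, -⟩
    exact ⟨k, hk, fun _ _ => trivial⟩
  have h0 : ¬ 0 < (A.process v hv).chain.runMeasure (([] : List A.Sym).map A.symEquiv)
      (MarkovChain.untilSet Set.univ (A.labelSet (some (j, true)))) := by
    rw [MarkovChain.runMeasure_untilSet_univ_pos_iff]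
    rintro ⟨t, ht, hr⟩
    obtain ⟨γ, hγ, rfl⟩ := (A.reflTransGen_support_chain v hv).1 hr
    have : γ = [] := by
      clear ht hr
      induction hγ with
      | refl => rfl
      | tail _ h ih => subst ih; exact h
    subst this
    exact A.nil_notMem_labelSet _ ht
  rw [success, measureReal_def, measure_mono_null h (by simpa using h0)]
  simp

theorem success_of_rhs_eq_nil {x : A.Sym} (β : List A.Sym) (h : ¬ A.Label (some (j, true)) x)
    (h' : ¬ A.Label (some (j, false)) x) (hx : A.rhs x = {[]}) (hb : x ≠ .bot) :
    A.success v hv j (x :: β) = A.success v hv j β := by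
  rw [A.success_cons v hv j β h h', hx, Finset.sum_singleton, weight, if_pos (by simp [hx]),
    if_neg hb, hx]
  simp

-- The symbol `botYes` counts as success in the dimension `base` only. In all other cases the stack
-- runs empty without success.
open scoped Classical in
theorem success_bot : A.success v hv j [.bot] = if j = A.base then (v : ℝ) else 0 := by
  rw [A.success_cons v hv j [] (by simp [Label]) (by simp [Label])]
  have hno : A.success v hv j [.botNo] = 0 := by
    rw [A.success_of_rhs_eq_nil v hv j [] (by simp [Label]) (by simp [Label]) rfl (by simp),
      success_nil]
  have hyes : A.success v hv j [.botYes] = if j = A.base then 1 else 0 := by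
    split_ifs with h
    · exact A.success_of_label v hv j [] h
    · rw [A.success_of_rhs_eq_nil v hv j (x := .botYes) [] h (by simp [Label]) rfl (by simp),
        success_nil]
  have e : A.rhs .bot = {[.botYes], [.botNo]} := rfl
  rw [e, Finset.sum_pair (by simp), List.append_nil, List.append_nil, hno, hyes, mul_zero, add_zero,
    weight, if_pos (by simp [e])]
  simp

theorem success_out (s : S) (i : Fin A.branch) (β : List A.Sym) :
    A.success v hv j (.out s i :: β) =
      if (i : ℕ) < A.shift j s then 1
      else if (i : ℕ) < A.shift j s + A.slope j s then A.success v hv j β else 0 := by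
  split_ifs with h h'
  · exact A.success_of_label v hv j β h
  · exact A.success_of_rhs_eq_nil v hv j β h (by simp [Label, h']) rfl (by simp)
  · exact A.success_of_fail v hv j β h (by simpa [Label] using h')

/-- Of the `branch` equally likely outcomes, the first `shift` succeed, the next `slope` are popped
and pass the decision on to `β`, and the others fail. -/
theorem success_mark (s : S) (β : List A.Sym) :
    A.success v hv j (.mark s :: β) = A.act j s (A.success v hv j β) := by
  classical
  rw [A.success_cons v hv j β (by simp [Label]) (by simp [Label])]
  have e : A.rhs (.mark s) = Finset.univ.image fun i => [.out s i] := by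
    simp only [rhs]
  have hinj : Function.Injective fun i : Fin A.branch => ([.out s i] : List A.Sym) := by
    intro i i' h
    simpa using h
  have hcard : (A.rhs (.mark s)).card = A.branch := by
    rw [e, Finset.card_image_of_injective _ hinj, Finset.card_univ, Fintype.card_fin]
  have hw : ∀ α ∈ A.rhs (.mark s), (A.weight v (.mark s) α : ℝ) = (A.branch : ℝ)⁻¹ := by
    intro α hα
    rw [weight, if_pos hα, if_neg (by simp), hcard]
    simp
  rw [Finset.sum_congr rfl fun α hα => by rw [hw α hα], ← Finset.mul_sum, e,
    Finset.sum_image hinj.injOn]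
  simp only [List.cons_append, List.nil_append, success_out]
  rw [Fin.sum_univ_eq_sum_range (fun i => if i < A.shift j s then (1 : ℝ)
      else if i < A.shift j s + A.slope j s then A.success v hv j β else 0)]
  -- Here `c` counts the failing outcomes; the sum splits into three blocks.
  obtain ⟨c, hc⟩ := Nat.exists_eq_add_of_le (A.le_branch j s)
  rw [act, hc, Finset.sum_range_add, Finset.sum_range_add,
    Finset.sum_congr rfl (g := fun _ => (1 : ℝ)) fun i hi => by simp [Finset.mem_range.1 hi],
    Finset.sum_congr (s₁ := Finset.range (A.slope j s)) rfl (g := fun _ => A.success v hv j β)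
      fun i hi => by simp [Finset.mem_range.1 hi],
    Finset.sum_congr (s₁ := Finset.range c) rfl (g := fun _ => (0 : ℝ))
      fun i hi => by rw [if_neg (by omega), if_neg (by omega)]]
  simp [div_eq_inv_mul]

/-- The last mark of the word lies on top and acts on the probability of the stack below it. Thus
popping from the top evaluates the word from its first mark on. -/
theorem success_stack (h : List S) : A.success v hv j (A.stack h) = A.value v j h := by
  induction h using List.reverseRecOn with
  | nil => exact A.success_bot v hv j
  | append_singleton h s ih =>
    have : A.stack (h ++ [s]) = .mark s :: A.stack h := by simp [stack]
    rw [this, success_mark, ih]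
    simp [value]

theorem edges_final : A.edges A.final = ∅ := by
  classical
  simp [edges, A.final_edge]

theorem success_final (h : List S) :
    A.success v hv j (.ctl A.final :: A.stack h) = A.value v j h := by
  rw [A.success_of_rhs_eq_nil v hv j _ (by simp [Label]) (by simp [Label]) _ (by simp),
    success_stack]
  simp only [rhs, edges_final, if_true]

end Success

/-! ### Reachable configurations -/

theorem Move.passive {β γ : List A.Sym} (h : A.Move β γ) (hβ : ∀ x ∈ β, A.Passive x) :
    ∀ x ∈ γ, A.Passive x := by
  classical
  cases β with
  | nil => rw [show γ = [] from h]; simp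
  | cons x β =>
    obtain ⟨α, hα, rfl⟩ := h
    have hx := hβ x (by simp)
    intro y hy
    rcases List.mem_append.1 hy with hy | hy
    · cases x with
      | start => exact hx.elim
      | ctl q => exact hx.elim
      | bot =>
        simp only [rhs, Finset.mem_insert, Finset.mem_singleton] at hα
        rcases hα with rfl | rfl <;> (simp only [List.mem_singleton] at hy; subst hy; trivial)
      | mark s =>
        obtain ⟨i, -, rfl⟩ := Finset.mem_image.1 hα
        simp only [List.mem_singleton] at hy
        subst hy
        trivial
      | _ => simp_all [rhs]
    · exact hβ y (by simp [hy])

/-- A control symbol remains on top while it follows edges. Once it is popped for lack of edges,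
passive symbols produce only passive ones, and no control symbol returns. -/
theorem reachable_start {γ : List A.Sym} (h : Relation.ReflTransGen A.Move [.start] γ) :
    γ = [.start] ∨ (∃ q w, A.Path A.start w q ∧ γ = .ctl q :: A.stack w) ∨
      ∀ x ∈ γ, A.Passive x := by
  classical
  induction h with
  | refl => exact .inl rfl
  | tail _ h ih =>
    right
    rcases ih with rfl | ⟨q, w, hw, rfl⟩ | ih
    · obtain ⟨α, hα, rfl⟩ := h
      left
      refine ⟨A.start, [], .nil _, ?_⟩
      simpa [rhs, stack] using hα
    · obtain ⟨α, hα, rfl⟩ := h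
      rw [rhs] at hα
      split_ifs at hα with he
      · right
        rw [Finset.mem_singleton.1 hα]
        exact A.passive_of_mem_stack w
      · obtain ⟨⟨s, q'⟩, hsq, rfl⟩ := Finset.mem_image.1 hα
        left
        refine ⟨q', w ++ [s], hw.append (.cons ?_ (.nil _)), by simp [stack]⟩
        simpa [edges] using hsq
    · exact .inr (Move.passive A h ih)

theorem reflTransGen_move_of_path {q q' : Q} {w : List S} (h : A.Path q w q') (β : List A.Sym) :
    Relation.ReflTransGen A.Move (.ctl q :: β) (.ctl q' :: ((w.map .mark).reverse ++ β)) := by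
  classical
  induction h generalizing β with
  | nil => exact .refl
  | @cons q q₁ q₂ s h e _ ih =>
    refine .head (b := .ctl q₁ :: .mark s :: β) ?_ (by simpa using ih (.mark s :: β))
    have hs : (s, q₁) ∈ A.edges q := by simpa [edges] using e
    refine ⟨[.ctl q₁, .mark s], ?_, rfl⟩
    rw [rhs, if_neg (Finset.ne_empty_of_mem hs)]
    exact Finset.mem_image.2 ⟨_, hs, rfl⟩

theorem exists_reachable_final_iff {P : List A.Sym → Prop} :
    (∃ β, Relation.ReflTransGen A.Move [.start] (.ctl A.final :: β) ∧ P β) ↔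
      ∃ w, A.Path A.start w A.final ∧ P (A.stack w) := by
  constructor
  · rintro ⟨β, h, hP⟩
    rcases A.reachable_start h with h | ⟨q, w, hw, h⟩ | h
    · simp at h
    · simp only [List.cons.injEq, StackSym.ctl.injEq] at h
      obtain ⟨rfl, rfl⟩ := h
      exact ⟨w, hw, hP⟩
    · exact (h (.ctl A.final) (by simp)).elim
  · rintro ⟨w, hw, hP⟩
    refine ⟨_, .head ⟨[.ctl A.start, .bot], ?_, rfl⟩ (A.reflTransGen_move_of_path hw [.bot]), hP⟩
    exact Finset.mem_singleton_self _

/-! ### The formula -/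

variable [Fintype J]

/-- The number of propositions. -/
abbrev numProps : ℕ := Fintype.card (Option (J × Bool))

/-- The numbering of the propositions. -/
noncomputable def propEquiv : Option (J × Bool) ≃ Fin (numProps (J := J)) := Fintype.equivFin _

/-- The probability of success in dimension `j` is one half. -/
noncomputable def halfFormula (j : J) : PCTL (Fin (numProps (J := J))) :=
  .probUntil .eq ⟨1 / 2, by norm_num, by norm_num⟩
    (.neg (.atom (propEquiv (some (j, false))))) (.atom (propEquiv (some (j, true))))

/-- With positive probability, the control reaches its final state with
probability one half of success in all dimensions. -/
noncomputable def formula : PCTL (Fin (numProps (J := J))) :=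
  .probUntil .gt ⟨0, by norm_num, by norm_num⟩ .tru
    (.and (.atom (propEquiv none))
      ((Finset.univ.toList.map halfFormula).foldr .and .tru))

theorem sat_foldr_and {AP T : Type} [MeasurableSpace T] [DiscreteMeasurableSpace T] [Countable T]
    (M : MarkovChain T) (ν : AP → Set T) (l : List (PCTL AP)) (s : T) :
    (l.foldr PCTL.and PCTL.tru).Sat M ν s ↔ ∀ Φ ∈ l, Φ.Sat M ν s := by
  induction l with
  | nil => simp [PCTL.Sat]
  | cons Φ l ih => simp [PCTL.Sat, ih]

/-- The formula holds at the start iff all values of some word of marks along a path from the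
start to the final state are one half. -/
theorem sat_formula_iff (v : ℚ) (hv : v ∈ Set.Ioo 0 1)
    {ν : Fin (numProps (J := J)) → Set (Config (Fintype.card A.Sym))}
    (hν : ∀ p, ν (propEquiv p) = A.labelSet p) :
    formula.Sat (A.process v hv).chain ν [A.symEquiv .start] ↔
      ∃ w, A.Path A.start w A.final ∧ ∀ j, A.value v j w = 1 / 2 := by
  have half : ∀ (j : J) β, (halfFormula j).Sat (A.process v hv).chain ν (β.map A.symEquiv) ↔
      A.success v hv j β = 1 / 2 := by
    intro j β
    simp only [halfFormula, PCTL.Sat, Cmp.Holds, hν]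
    rw [show ((1 / 2 : ℚ) : ℝ) = 1 / 2 by norm_num]
    rfl
  have key : formula.Sat (A.process v hv).chain ν [A.symEquiv .start] ↔
      ∃ β, Relation.ReflTransGen A.Move [.start] (.ctl A.final :: β) ∧
        ∀ j : J, A.success v hv j (.ctl A.final :: β) = 1 / 2 := by
    have h1 : formula.Sat (A.process v hv).chain ν [A.symEquiv .start] ↔
        0 < ((A.process v hv).chain.runMeasure ([.start].map A.symEquiv))
          (MarkovChain.untilSet Set.univ
            {t | t ∈ A.labelSet none ∧
              ∀ j : J, (halfFormula j).Sat (A.process v hv).chain ν t}) := by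
      have hpos : ∀ E, (0 : ℝ) < ((A.process v hv).chain.runMeasure
          ([.start].map A.symEquiv)).real E ↔
            0 < ((A.process v hv).chain.runMeasure ([.start].map A.symEquiv)) E := by
        intro E
        rw [measureReal_def, ENNReal.toReal_pos_iff]
        exact and_iff_left (measure_lt_top _ _)
      rw [← hpos]
      simp only [formula, PCTL.Sat, Cmp.Holds, hν, sat_foldr_and, List.forall_mem_map,
        Finset.mem_toList, Finset.mem_univ, true_imp_iff, Rat.cast_zero]
      rfl
    rw [h1, MarkovChain.runMeasure_untilSet_univ_pos_iff]
    simp only [A.reflTransGen_support_chain v hv]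
    constructor
    · rintro ⟨t, ⟨ht, hj⟩, γ, hγ, rfl⟩
      cases γ with
      | nil => exact (A.nil_notMem_labelSet _ ht).elim
      | cons x β =>
        rw [A.map_cons_mem_labelSet] at ht
        obtain rfl : x = .ctl A.final := ht
        exact ⟨β, hγ, fun j => (half j _).1 (hj j)⟩
    · rintro ⟨β, hβ, hj⟩
      exact ⟨_, ⟨(A.map_cons_mem_labelSet _ _ _).2 rfl, fun j => (half j _).2 (hj j)⟩, _, hβ, rfl⟩
  rw [key, A.exists_reachable_final_iff
    (P := fun β => ∀ j, A.success v hv j (.ctl A.final :: β) = 1 / 2)]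
  simp only [success_final]

end AffineAutomaton

/-! ### Machines with several stacks -/

/-- The operations of a machine with stacks `K` over the alphabet `A`. The operation
`letter k a r w` works at the top of the stack `k`: it removes the letter `a` if `r` holds, and then
adds the letter `a` if `w` holds. The operation `empty k` tests that the stack `k` is empty. -/
inductive StackOp (K A : Type)
  | letter (k : K) (a : A) (r w : Bool)
  | empty (k : K)
  | skip

/-- The effect of an operation on the stacks. -/
def StackOp.Acts {K A : Type} [DecidableEq K] :
    StackOp K A → (K → List A) → (K → List A) → Prop
  | letter k a r w, T, T' => ∃ l, T k = (if r then a :: l else l) ∧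
      T' = Function.update T k (if w then a :: l else l)
  | empty k, T, T' => T k = [] ∧ T' = T
  | skip, T, T' => T' = T

/-- A nondeterministic machine with several stacks. -/
structure StackMachine (K A Q : Type) where
  step : Q → StackOp K A → Q → Prop
  init : Q
  halt : Q

namespace StackMachine

variable {K A Q : Type} [DecidableEq K] (M : StackMachine K A Q)

/-- One step on the configurations. -/
def Step (c d : Q × (K → List A)) : Prop := ∃ op, M.step c.1 op d.1 ∧ op.Acts c.2 d.2

/-- The machine can halt. -/
def Halts (q : Q) (T : K → List A) : Prop :=
  ∃ T', Relation.ReflTransGen M.Step (q, T) (M.halt, T')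

variable {M} in
theorem Halts.of_step {q q' : Q} {T T' : K → List A} {op : StackOp K A} (h : M.step q op q')
    (ha : op.Acts T T') (h' : M.Halts q' T') : M.Halts q T := by
  obtain ⟨T'', h''⟩ := h'
  exact ⟨T'', .head ⟨op, h, ha⟩ h''⟩

end StackMachine

/-! ### Histories of stack machines -/

/-- The marks of a history. The mark `letter k x r w` reads `x` from the previous version
of the stack `k` if `r` holds, and writes `x` to its next version if `w` holds; here `x = none` is
the end marker of a version. -/
inductive HistMark (K A : Type)
  | reset
  | skip
  | letter (k : K) (x : Option A) (r w : Bool)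
  | fix (k : K) (f : FixMove)
  deriving Fintype

/-- The control states of a history. -/
inductive HistCtl (K Q : Type)
  | pre
  | main (q : Q)
  | copy (k : K) (q : Q)
  | flush
  | fix
  | final
  deriving Fintype

namespace StackMachine

variable {K A Q : Type} (M : StackMachine K A Q)

/-- The control graph of the histories. A step writes a new version of one stack: first the
operation at the top, then a copy of the rest. -/
inductive HistEdge : HistCtl K Q → HistMark K A → HistCtl K Q → Prop
  | pre : HistEdge .pre .reset (.main M.init)
  | letter {q q' k a r w} (h : M.step q (.letter k a r w) q') :
      HistEdge (.main q) (.letter k (some a) r w) (.copy k q')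
  | empty {q q' k} (h : M.step q (.empty k) q') :
      HistEdge (.main q) (.letter k none true true) (.main q')
  | skip {q q'} (h : M.step q .skip q') : HistEdge (.main q) .skip (.main q')
  | copy {k q} (a : A) : HistEdge (.copy k q) (.letter k (some a) true true) (.copy k q)
  | sep {k q} : HistEdge (.copy k q) (.letter k none true true) (.main q)
  | halt : HistEdge (.main M.halt) .skip .flush
  | flush (k : K) (x : Option A) : HistEdge .flush (.letter k x true false) .flush
  | toFix : HistEdge .flush .skip .fix
  | fix (k : K) (f : FixMove) : HistEdge .fix (.fix k f) .fix
  | toFinal : HistEdge .fix .skip .final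

open scoped Classical in
/-- The dimension `(k, false)` collects what is read from the stack `k`, and `(k, true)` what is
written to it. Letters are base-`8` digits according to `enc`. -/
noncomputable def histAutomaton (enc : Option A → Fin 8) (k₀ : K) :
    AffineAutomaton (HistCtl K Q) (HistMark K A) (K × Bool) where
  -- A common multiple of the denominators that occur: `8` for a digit, `3` for a contraction, `2`
  -- and `16` for `reset`.
  branch := 48
  branch_pos := by norm_num
  edge := M.HistEdge
  start := .pre
  final := .final
  final_edge s q h := nomatch h
  shift j s := match s with
    -- Reading starts from `24 / 48 = 1 / 2`, the value of the empty word. Writing starts from the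
    -- end marker of an empty stack, `(enc none + 1 / 2) / 8`, except that the stack `k₀` keeps its
    -- value, which encodes the input.
    | .reset => if j.2 then (if j.1 = k₀ then 0 else 3 * (2 * enc none + 1)) else 24
    | .skip => 0
    | .letter k x r w => if k = j.1 ∧ (if j.2 then w else r) = true then 6 * enc x else 0
    | .fix k f => if k = j.1 then 16 * f.shift else 0
  slope j s := match s with
    | .reset => if j.2 then (if j.1 = k₀ then 48 else 0) else 0
    | .skip => 48
    | .letter k _ r w => if k = j.1 ∧ (if j.2 then w else r) = true then 6 else 48
    | .fix k f => if k = j.1 then 16 * f.slope else 48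
  le_branch j s := by
    cases s with
    | reset => have := (enc none).2; simp only; split_ifs <;> omega
    | skip => simp
    | letter k x r w => have := (enc x).2; simp only; split_ifs <;> omega
    | fix k f => have := f.shift_add_slope_le; simp only; split_ifs <;> omega
  base := (k₀, true)

/-- What a history reads from the stack `k` or writes to it. -/
def histWord [DecidableEq K] (k : K) (b : Bool) : List (HistMark K A) → List (Option A)
  | [] => []
  | .letter k' x r w :: h =>
      if k' = k ∧ (if b then w else r) = true then x :: histWord k b h else histWord k b h
  | _ :: h => histWord k b h

theorem histWord_append [DecidableEq K] (k : K) (b : Bool) (h h' : List (HistMark K A)) :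
    histWord k b (h ++ h') = histWord k b h ++ histWord k b h' := by
  induction h with
  | nil => rfl
  | cons s h ih =>
    cases s <;> simp only [List.cons_append, histWord, ih]
    split_ifs <;> rfl

/-! ### Paths of the control graph -/

section Paths

variable (enc : Option A → Fin 8) (k₀ : K)

theorem path_copy (k : K) (q : Q) (l : List A) :
    (M.histAutomaton enc k₀).Path (.copy k q)
      (l.map (fun a => HistMark.letter k (some a) true true) ++ [.letter k none true true])
      (.main q) := by
  induction l with
  | nil => exact .cons .sep (.nil _)
  | cons a l ih => exact .cons (.copy a) ih

theorem path_flush (h : List (K × Option A)) :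
    (M.histAutomaton enc k₀).Path .flush (h.map fun x => .letter x.1 x.2 true false) .flush := by
  induction h with
  | nil => exact .nil _
  | cons x h ih => exact .cons (.flush _ _) ih

theorem path_fix (l : List (K × FixMove)) :
    (M.histAutomaton enc k₀).Path .fix ((l.map fun y => .fix y.1 y.2) ++ [.skip]) .final := by
  induction l with
  | nil => exact .cons .toFinal (.nil _)
  | cons y l ih => exact .cons (.fix _ _) ih

/-- The marks that only read and write letters. -/
def IsPlain : HistMark K A → Prop
  | .skip => True
  | .letter _ _ _ _ => True
  | _ => False

/-- The mark `reset` needs the state `pre`, which no edge enters. The `fix` marks need the state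
`fix`, from which `flush` is out of reach. -/
theorem isPlain_of_path {c c' : HistCtl K Q} {h : List (HistMark K A)}
    (p : (M.histAutomaton enc k₀).Path c h c') (hc' : c' = .flush) (hc : c ≠ .pre) :
    ∀ s ∈ h, IsPlain s := by
  have from_fix : ∀ {c c' : HistCtl K Q} {h : List (HistMark K A)},
      (M.histAutomaton enc k₀).Path c h c' → c = .fix ∨ c = .final → c' ≠ .flush := by
    intro c c' h p hc
    induction p with
    | nil => rintro rfl; simp at hc
    | cons e _ ih =>
      rcases hc with rfl | rfl
      · cases e with
        | fix => exact ih (.inl rfl)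
        | toFinal => exact ih (.inr rfl)
      · cases e
  induction p with
  | nil => simp
  | cons e p ih =>
    intro s hs
    rcases List.mem_cons.1 hs with rfl | hs
    · cases e with
      | pre => exact (hc rfl).elim
      | fix => exact (from_fix p (.inl rfl) hc').elim
      | _ => trivial
    · refine ih hc' ?_ s hs
      rintro rfl
      cases e

/-- This separates the letters of a history from its contractions: the only way into `fix` from
another state is a `skip` at `flush`, and the only way out is a `skip` to `final`. -/
theorem path_final_cases {c c' : HistCtl K Q} {h : List (HistMark K A)}
    (p : (M.histAutomaton enc k₀).Path c h c') (hc : c' = .final) :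
    (c = .final → h = []) ∧
    (c = .fix → ∃ l : List (K × FixMove), h = (l.map fun y => .fix y.1 y.2) ++ [.skip]) ∧
    (c ≠ .final → c ≠ .fix → ∃ h' : List (HistMark K A), ∃ l : List (K × FixMove),
      (M.histAutomaton enc k₀).Path c h' .flush ∧
      h = h' ++ .skip :: ((l.map fun y => .fix y.1 y.2) ++ [.skip])) := by
  induction p with
  | nil => subst hc; simp
  | cons e p ih =>
    obtain ⟨ih1, ih2, ih3⟩ := ih hc
    refine ⟨?_, ?_, ?_⟩
    · rintro rfl; cases e
    · rintro rfl
      cases e with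
      | fix k f =>
        obtain ⟨l, rfl⟩ := ih2 rfl
        exact ⟨(k, f) :: l, rfl⟩
      | toFinal => rw [ih1 rfl]; exact ⟨[], rfl⟩
    · intro h1 h2
      rename_i c c₁ c₂ s h
      have hfin : c₁ ≠ .final := by
        rintro rfl
        cases e
        exact h2 rfl
      by_cases hf : c₁ = .fix
      · subst hf
        cases e with
        | toFix =>
          obtain ⟨l, rfl⟩ := ih2 rfl
          exact ⟨[], l, .nil _, rfl⟩
        | fix => exact (h2 rfl).elim
      · obtain ⟨h', l, hp, rfl⟩ := ih3 hfin hf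
        exact ⟨s :: h', l, .cons e hp, rfl⟩

end Paths

/-! ### Histories and runs -/

section Runs

variable [DecidableEq K] (enc : Option A → Fin 8) (k₀ : K)

variable {M enc k₀} in
/-- In a history that is read as it was written, the machine halts. -/
theorem halts_of_path {c : HistCtl K Q} {h : List (HistMark K A)}
    (p : (M.histAutomaton enc k₀).Path c h .flush) :
    (∀ q T, c = .main q →
      (∀ k, histWord k false h = (T k).map some ++ none :: histWord k true h) → M.Halts q T) ∧
    (∀ k q T l l', c = .copy k q →
      (∀ k', k' ≠ k → histWord k' false h = (T k').map some ++ none :: histWord k' true h) →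
      histWord k false h = l.map some ++ none :: (l'.map some ++ histWord k true h) →
      M.Halts q (Function.update T k (l' ++ l))) := by
  -- The invariant at a main state: what is still to be read from a stack is its contents, an end
  -- marker, and all that is still to be written to it. During a copy, `l` is the unread rest of the
  -- stack `k`, and `l'` is the part of its next version that is already written.
  generalize hc : HistCtl.flush = c' at p
  induction p with
  | nil => subst hc; exact ⟨fun _ _ h => (nomatch h), fun _ _ _ _ _ h => (nomatch h)⟩
  | @cons c c₁ c₂ s h e p ih =>
    obtain ⟨ihm, ihc⟩ := ih hc
    subst hc
    constructor
    · rintro q T rfl hT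
      cases e with
      | @letter _ q' k a r w hs =>
        have hk := hT k
        simp only [histWord, true_and] at hk
        -- If the mark reads `a`, the invariant forces `a` to be the top letter. The rest `l` has to
        -- be copied, and the next version starts with `a` exactly if `w` holds.
        obtain ⟨l, hl, hl'⟩ : ∃ l, T k = (if r then a :: l else l) ∧
            histWord k false h = l.map some ++ none ::
              ((if w then [a] else []).map some ++ histWord k true h) := by
          cases r
          · refine ⟨T k, rfl, ?_⟩
            cases w <;> simpa using hk
          · cases hTk : T k with
            | nil => simp [hTk] at hk
            | cons b l =>
              rw [hTk] at hk
              simp only [Bool.false_eq_true, if_false, if_true, List.map_cons, List.cons_append,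
                List.cons.injEq, Option.some.injEq] at hk
              obtain ⟨rfl, hk⟩ := hk
              refine ⟨l, rfl, ?_⟩
              cases w <;> simpa using hk
        refine .of_step hs ⟨l, hl, rfl⟩ ?_
        have := ihc k q' T l (if w then [a] else []) rfl (fun k' hk' => ?_) hl'
        · cases w <;> simpa using this
        · have := hT k'
          simpa [histWord, Ne.symm hk'] using this
      | @empty _ q' k hs =>
        have hk := hT k
        simp only [histWord, true_and, Bool.false_eq_true, if_false, if_true] at hk
        have hTk : T k = [] := by
          cases hTk : T k with
          | nil => rfl
          | cons b l => simp [hTk] at hk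
        refine .of_step hs ⟨hTk, rfl⟩ (ihm q' T rfl fun k' => ?_)
        by_cases hkk : k = k'
        · subst hkk
          simpa [hTk] using hk
        · simpa [histWord, hkk] using hT k'
      | skip hs => exact .of_step hs rfl (ihm _ T rfl fun k => by simpa [histWord] using hT k)
      | halt => exact ⟨T, .refl⟩
    · rintro k q T l l' rfl hT hk
      cases e with
      | copy a =>
        simp only [histWord, true_and, Bool.false_eq_true, if_false, if_true] at hk
        cases l with
        | nil => simp at hk
        | cons b l =>
          simp only [List.map_cons, List.cons_append, List.cons.injEq, Option.some.injEq] at hk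
          obtain ⟨rfl, hk⟩ := hk
          have := ihc k q T l (l' ++ [a]) rfl (fun k' hk' => ?_) (by simpa using hk)
          · simpa using this
          · simpa [histWord, Ne.symm hk'] using hT k' hk'
      | sep =>
        simp only [histWord, true_and, Bool.false_eq_true, if_false, if_true] at hk
        cases l with
        | cons b l => simp at hk
        | nil =>
          refine ihm q _ rfl fun k' => ?_
          by_cases hkk : k' = k
          · subst hkk
            simpa using hk
          · simpa [histWord, Ne.symm hkk, hkk] using hT k' hkk

theorem histWord_map_letter (k k' : K) (b r w : Bool) (l : List (Option A)) :
    histWord k b (l.map fun x => HistMark.letter k' x r w) =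
      if k' = k ∧ (if b then w else r) = true then l else [] := by
  induction l with
  | nil => simp [histWord]
  | cons x l ih =>
    simp only [List.map_cons, histWord, ih]
    split_ifs <;> rfl

theorem histWord_copy (k k' : K) (b : Bool) (l : List A) :
    histWord k b (l.map (fun a => HistMark.letter k' (some a) true true) ++
      [.letter k' none true true]) = if k' = k then l.map some ++ [none] else [] := by
  have := histWord_map_letter k k' b true true (l.map some ++ [none])
  simpa [Function.comp_def] using this

variable {M} in
/-- Every halting run has a history that is read as it was written. -/
theorem exists_path_of_halts [Fintype K] {q : Q} {T : K → List A} (h : M.Halts q T) :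
    ∃ w, (M.histAutomaton enc k₀).Path (.main q) w .flush ∧
      ∀ k, histWord k false w = (T k).map some ++ none :: histWord k true w := by
  obtain ⟨T', h⟩ := h
  generalize hc : (q, T) = c at h
  induction h using Relation.ReflTransGen.head_induction_on generalizing q T with
  | refl =>
    obtain ⟨rfl, rfl⟩ := Prod.mk.inj hc
    -- When the machine halts, the last version of every stack is still unread; `flush` reads these
    -- versions and writes nothing.
    refine ⟨.skip :: ((Finset.univ : Finset K).toList.flatMap fun k =>
      ((T k).map some ++ [none]).map fun x => (k, x)).map fun x => .letter x.1 x.2 true false,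
      .cons .halt (path_flush ..), fun k => ?_⟩
    have aux : ∀ (b : Bool) (L : List K), L.Nodup → histWord k b
        ((L.flatMap fun k => ((T k).map some ++ [none]).map fun x => (k, x)).map
          fun x => HistMark.letter x.1 x.2 true false) =
        if k ∈ L ∧ b = false then (T k).map some ++ [none] else [] := by
      intro b L hL
      induction L with
      | nil => simp [histWord]
      | cons k' L ih =>
        rw [List.flatMap_cons, List.map_append, histWord_append, ih hL.of_cons, List.map_map]
        have := histWord_map_letter k k' b true false ((T k').map some ++ [none])
        simp only [Function.comp_def]
        rw [this]
        have hk' : k' ∉ L := (List.nodup_cons.1 hL).1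
        by_cases hkk : k' = k
        · subst hkk
          cases b <;> simp [hk']
        · cases b <;> simp [hkk, Ne.symm hkk]
    simp only [histWord]
    rw [aux _ _ (Finset.nodup_toList _), aux _ _ (Finset.nodup_toList _)]
    simp
  | @head c c' hcc _ ih =>
    obtain ⟨q', T''⟩ := c'
    obtain ⟨op, hs, ha⟩ := hcc
    obtain ⟨w, hw, hword⟩ := ih rfl
    subst hc
    cases op with
    | letter k a r w' =>
      obtain ⟨l, hl, rfl⟩ := ha
      refine ⟨.letter k (some a) r w' :: ((l.map (fun a => HistMark.letter k (some a) true true) ++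
        [.letter k none true true]) ++ w), .cons (.letter hs) ((path_copy ..).append hw),
        fun k' => ?_⟩
      have := hword k'
      simp only [histWord, histWord_append _ _ (_ ++ _), histWord_copy]
      simp only at hl
      by_cases hkk : k = k'
      · subst hkk
        rw [Function.update_self] at this
        rw [this, hl]
        cases r <;> cases w' <;> simp
      · rw [Function.update_of_ne (Ne.symm hkk)] at this
        simpa [hkk] using this
    | empty k =>
      obtain ⟨hTk, rfl⟩ := ha
      refine ⟨.letter k none true true :: w, .cons (.empty hs) hw, fun k' => ?_⟩
      have := hword k'
      simp only at hTk this
      simp only [histWord]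
      by_cases hkk : k = k'
      · subst hkk
        simp [this, hTk]
      · simpa [hkk] using this
    | skip =>
      obtain rfl := ha
      exact ⟨.skip :: w, .cons (.skip hs) hw, fun k => by simpa [histWord] using hword k⟩

end Runs

/-! ### Values of histories -/

section Values

variable [DecidableEq K] (enc : Option A → Fin 8) (k₀ : K)

/-- As `6 / 48 = 1 / 8`, a letter that belongs to the dimension puts its digit in front. The other
plain marks act as `48 / 48`, the identity. -/
theorem foldl_act_plain (k : K) (b : Bool) (h : List (HistMark K A)) (hh : ∀ s ∈ h, IsPlain s)
    (x : ℝ) :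
    h.foldl (fun x s => (M.histAutomaton enc k₀).act (k, b) s x) x =
      digitValue x ((histWord k b h).map enc) := by
  induction h generalizing x with
  | nil => rfl
  | cons s h ih =>
    rw [List.foldl_cons, ih fun s hs => hh s (by simp [hs])]
    cases s with
    | reset => exact (hh .reset (by simp)).elim
    | fix k f => exact (hh (.fix k f) (by simp)).elim
    | skip =>
      congr 1
      simp [AffineAutomaton.act, histAutomaton]
    | letter k' y r w =>
      simp only [histWord]
      by_cases hk : k' = k ∧ (if b then w else r) = true
      · rw [if_pos hk, List.map_cons]
        change _ = digitValue (((enc y : ℕ) + x) / 8) _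
        congr 1
        simp only [AffineAutomaton.act, histAutomaton, if_pos hk]
        push_cast
        ring
      · rw [if_neg hk]
        congr 1
        simp only [AffineAutomaton.act, histAutomaton, if_neg hk]
        simp

/-- The contractions of the stack `k`. -/
def fixMoves (k : K) (l : List (K × FixMove)) : List FixMove :=
  (l.filter fun x => x.1 = k).map Prod.snd

/-- As `16 / 48 = 1 / 3`, the mark acts as its contraction. The result does not depend on `b`: what
is read and what is written undergo the same contractions. -/
theorem foldl_act_fix (k : K) (b : Bool) (l : List (K × FixMove)) (x : ℝ) :
    (l.map fun y => HistMark.fix y.1 y.2).foldl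
      (fun x s => (M.histAutomaton enc k₀).act (k, b) s x) x = FixMove.mapList (fixMoves k l) x := by
  induction l generalizing x with
  | nil => rfl
  | cons y l ih =>
    rw [List.map_cons, List.foldl_cons, ih]
    by_cases hy : y.1 = k
    · have : fixMoves k (y :: l) = y.2 :: fixMoves k l := by simp [fixMoves, hy]
      rw [this]
      change _ = FixMove.mapList (fixMoves k l) (y.2.map x)
      congr 1
      simp only [AffineAutomaton.act, histAutomaton, if_pos hy, FixMove.map]
      push_cast
      ring
    · have : fixMoves k (y :: l) = fixMoves k l := by simp [fixMoves, hy]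
      rw [this]
      congr 1
      simp only [AffineAutomaton.act, histAutomaton, if_neg hy]
      simp

theorem act_skip (j : K × Bool) (x : ℝ) : (M.histAutomaton enc k₀).act j .skip x = x := by
  simp [AffineAutomaton.act, histAutomaton]

/-- The initial contents of the stacks. -/
def initStacks (input : List A) : K → List A := Function.update (fun _ => []) k₀ input

/-- The value of a history: first the letters, then the contractions. -/
theorem value_history (input : List A) {v : ℚ}
    (hv : (v : ℝ) = digitValue (1 / 2) ((input.map some ++ [none]).map enc))
    (k : K) (b : Bool) (h : List (HistMark K A)) (hh : ∀ s ∈ h, IsPlain s)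
    (l : List (K × FixMove)) :
    (M.histAutomaton enc k₀).value v (k, b)
        (.reset :: (h ++ .skip :: ((l.map fun y => .fix y.1 y.2) ++ [.skip]))) =
      FixMove.mapList (fixMoves k l) (digitValue (1 / 2)
        (((if b then (initStacks k₀ input k).map some ++ [none] else []) ++ histWord k b h).map
          enc)) := by
  classical
  rw [AffineAutomaton.value, List.foldl_cons, List.foldl_append, List.foldl_cons, List.foldl_append,
    foldl_act_plain _ _ _ _ _ _ hh, foldl_act_fix, act_skip, List.foldl_cons, List.foldl_nil,
    act_skip, List.map_append, digitValue_append]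
  -- It remains to check that `reset` yields the number of the initial word: empty for reading, the
  -- input with its end marker on `k₀`, a lone end marker on the other stacks.
  congr 2
  have hbase : (M.histAutomaton enc k₀).base = (k₀, true) := rfl
  rw [hbase]
  cases b
  · simp [AffineAutomaton.act, histAutomaton, digitValue]
    norm_num
  · by_cases hk : k = k₀
    · subst hk
      simp only [AffineAutomaton.act, histAutomaton, initStacks, Function.update_self, if_true, ← hv]
      simp
    · simp only [AffineAutomaton.act, histAutomaton, initStacks, Function.update_of_ne hk, if_true,
        if_neg hk, digitValue]
      push_cast
      simp
      ring

theorem fixMoves_flatMap (w : K → List FixMove) (k : K) (L : List K) (hL : L.Nodup) :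
    fixMoves k (L.flatMap fun k => (w k).map fun f => (k, f)) = if k ∈ L then w k else [] := by
  induction L with
  | nil => rfl
  | cons k' L ih =>
    have happ : ∀ l l' : List (K × FixMove), fixMoves k (l ++ l') = fixMoves k l ++ fixMoves k l' :=
      fun l l' => by simp [fixMoves]
    have hk' : k' ∉ L := (List.nodup_cons.1 hL).1
    rw [List.flatMap_cons, happ, ih hL.of_cons]
    by_cases hkk : k' = k
    · subst hkk
      simp [fixMoves, hk', List.filter_map, Function.comp_def]
    · simp [fixMoves, hkk, Ne.symm hkk, List.filter_map, Function.comp_def]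

/-- The machine halts on an input iff all values of some complete history are one half. -/
theorem exists_value_eq_half_iff [Fintype K] (henc : Function.Injective enc) (input : List A) {v : ℚ}
    (hv : (v : ℝ) = digitValue (1 / 2) ((input.map some ++ [none]).map enc)) :
    (∃ w, (M.histAutomaton enc k₀).Path .pre w .final ∧
      ∀ j, (M.histAutomaton enc k₀).value v j w = 1 / 2) ↔
      M.Halts M.init (initStacks k₀ input) := by
  constructor
  · rintro ⟨w, hw, hval⟩
    cases hw with
    | cons e p =>
      cases e
      obtain ⟨h, l, hp, rfl⟩ := (M.path_final_cases enc k₀ p rfl).2.2 (by simp) (by simp)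
      have hplain := M.isPlain_of_path enc k₀ hp rfl (by simp)
      refine (halts_of_path hp).1 _ _ rfl fun k => ?_
      have h0 := hval (k, false)
      have h1 := hval (k, true)
      rw [M.value_history enc k₀ input hv k _ h hplain l] at h0 h1
      -- Both dimensions of `k` went through the same contractions to `1 / 2`, so their digit words
      -- agree.
      have := digitValue_half_injective (FixMove.mapList_injective _ (h0.trans h1.symm))
      simpa using List.map_injective_iff.2 henc this
  · intro h
    obtain ⟨w, hw, hword⟩ := exists_path_of_halts enc k₀ h
    have hplain := M.isPlain_of_path enc k₀ hw rfl (by simp)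
    -- Contractions chosen for the word read also serve for the word written, which is the same by
    -- `hword`.
    have hfix : ∀ k, ∃ m, FixMove.mapList m
        (digitValue (1 / 2) ((histWord k false w).map enc)) = 1 / 2 := by
      intro k
      obtain ⟨n, m, hodd, h0, h1, he⟩ := digitValue_half_eq_dyadic ((histWord k false w).map enc)
      rw [he]
      exact FixMove.exists_mapList_eq_half n m hodd h0 h1
    choose m hm using hfix
    refine ⟨_, .cons .pre (hw.append (.cons .toFix (M.path_fix enc k₀
      ((Finset.univ : Finset K).toList.flatMap fun k => (m k).map fun f => (k, f))))), ?_⟩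
    rintro ⟨k, b⟩
    rw [M.value_history enc k₀ input hv k b w hplain, fixMoves_flatMap _ _ _ (Finset.nodup_toList _),
      if_pos (by simp)]
    refine Eq.trans ?_ (hm k)
    congr 3
    cases b <;> simp [hword k]

end Values

end StackMachine

/-! ### Turing machines with several stacks as stack machines -/

namespace StackMachine

open Turing

variable {K A Λ σ : Type}

/-- The statements of the multi-stack model, over the same alphabet for all stacks. -/
abbrev Stmt (K A Λ σ : Type) := TM2.Stmt (fun _ : K => A) Λ σ

variable (M : Λ → Stmt K A Λ σ)

/-- The elementary steps of the statements; `none` is the halting state. -/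
inductive StmtStep : Stmt K A Λ σ → σ → StackOp K A → Option (Stmt K A Λ σ × σ) → Prop
  | push (k f q v) : StmtStep (.push k f q) v (.letter k (f v) false true) (some (q, v))
  | peekSome (k f q v a) : StmtStep (.peek k f q) v (.letter k a true true) (some (q, f v (some a)))
  | peekNone (k f q v) : StmtStep (.peek k f q) v (.empty k) (some (q, f v none))
  | popSome (k f q v a) : StmtStep (.pop k f q) v (.letter k a true false) (some (q, f v (some a)))
  | popNone (k f q v) : StmtStep (.pop k f q) v (.empty k) (some (q, f v none))
  | load (f q v) : StmtStep (.load f q) v .skip (some (q, f v))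
  | branch (f q₁ q₂ v) : StmtStep (.branch f q₁ q₂) v .skip (some (cond (f v) q₁ q₂, v))
  | goto (f v) : StmtStep (.goto f) v .skip (some (M (f v), v))
  | halt (v) : StmtStep .halt v .skip none

open scoped Classical in
/-- The statements that can occur when the labels in `L` are run. -/
noncomputable def stmtSet (L : Finset Λ) : Finset (Stmt K A Λ σ) :=
  L.biUnion fun l => TM2.stmts₁ (M l)

variable {M} in
theorem mem_stmtSet {L : Finset Λ} {q : Stmt K A Λ σ} : q ∈ stmtSet M L ↔ ∃ l ∈ L, q ∈ TM2.stmts₁ (M l) := by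
  classical
  simp [stmtSet]

/-- The control states for the labels in `L`. -/
abbrev StmtState (L : Finset Λ) := Option ({q // q ∈ stmtSet M L} × σ)

/-- The stack machine that runs the labels in `L`, from the label `l` and the store `v`. -/
def ofTM2 (L : Finset Λ) (l : Λ) (hl : l ∈ L) (v : σ) : StackMachine K A (StmtState M L) where
  step c op c' := ∃ x, c = some x ∧ StmtStep M x.1 x.2 op (c'.map fun y => (y.1.1, y.2))
  init := some (⟨M l, mem_stmtSet.2 ⟨l, hl, TM2.stmts₁_self⟩⟩, v)
  halt := none

variable [DecidableEq K] {M} {L : Finset Λ} {l : Λ} {hl : l ∈ L} {v₀ : σ}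

/-- The stack machine guesses the top letter or the emptiness of a stack, but the operation acts
only if the guess is right. So each of its steps is the one that the Turing machine makes. -/
theorem eval_dom_of_halts {c : StmtState M L} {T : K → List A}
    (h : (ofTM2 M L l hl v₀).Halts c T) :
    ∀ q v, c = some (q, v) → (StateTransition.eval (TM2.step M) (TM2.stepAux q.1 v T)).Dom := by
  obtain ⟨T', h⟩ := h
  generalize hx : (c, T) = x at h
  induction h using Relation.ReflTransGen.head_induction_on generalizing c T with
  | refl =>
    obtain ⟨rfl, rfl⟩ := Prod.mk.inj hx
    exact fun q v h => nomatch h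
  | @head x y hxy _ ih =>
    subst hx
    obtain ⟨c', T''⟩ := y
    replace ih := ih rfl
    obtain ⟨op, ⟨x, rfl, hs⟩, ha⟩ := hxy
    simp only at hs ha
    rintro q v hq
    obtain rfl := Option.some.inj hq
    cases c' with
    | none =>
      simp only [Option.map_none] at hs
      generalize hqq : q.1 = q' at hs
      cases hs
      rw [TM2.stepAux]
      exact Part.dom_iff_mem.2 ⟨_, StateTransition.mem_eval.2 ⟨.refl, rfl⟩⟩
    | some y =>
      obtain ⟨q', v'⟩ := y
      replace ih := ih q' v' rfl
      simp only [Option.map_some] at hs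
      generalize hq1 : q.1 = r at hs ⊢
      generalize hq2 : q'.1 = r' at hs ih
      cases hs with
      | push k f =>
        obtain ⟨l, hl, rfl⟩ := ha
        simp only [Bool.false_eq_true, if_false, if_true] at hl ih
        rwa [TM2.stepAux, hl]
      | peekSome k f q v a =>
        obtain ⟨l, hl, rfl⟩ := ha
        simp only [if_true] at hl ih
        -- A `peek` removes the letter and puts it back.
        rw [← hl, Function.update_eq_self] at ih
        rwa [TM2.stepAux, hl]
      | peekNone k f =>
        obtain ⟨hl, rfl⟩ := ha
        rwa [TM2.stepAux, hl]
      | popSome k f q v a =>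
        obtain ⟨l, hl, rfl⟩ := ha
        simp only [Bool.false_eq_true, if_false, if_true] at hl ih
        rwa [TM2.stepAux, hl]
      | popNone k f =>
        obtain ⟨hl, rfl⟩ := ha
        rw [TM2.stepAux, hl]
        rwa [show Function.update T'' k ([] : List A).tail = T'' by
          rw [List.tail_nil, ← hl, Function.update_eq_self]]
      | load f =>
        obtain rfl := ha
        rwa [TM2.stepAux]
      | branch f q₁ q₂ =>
        obtain rfl := ha
        rw [TM2.stepAux]
        cases h : f v <;> simpa [h] using ih
      | goto f =>
        obtain rfl := ha
        rw [TM2.stepAux, StateTransition.reaches_eval (b := TM2.stepAux (M (f v)) v T'')]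
        · exact ih
        · exact .single rfl

/-- From the statement `q`, the stack machine reaches the end of the statement as the Turing
machine does. -/
def Simulates (N : StackMachine K A (StmtState M L)) (q : Stmt K A Λ σ) (hq : q ∈ stmtSet M L)
    (v : σ) (T : K → List A) : Prop :=
  (∃ v' T', TM2.stepAux q v T = ⟨none, v', T'⟩ ∧
    Relation.ReflTransGen N.Step (some (⟨q, hq⟩, v), T) (none, T')) ∨
  (∃ l' v' T', ∃ hl' : M l' ∈ stmtSet M L, TM2.stepAux q v T = ⟨some l', v', T'⟩ ∧
    Relation.ReflTransGen N.Step (some (⟨q, hq⟩, v), T) (some (⟨M l', hl'⟩, v'), T'))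

theorem Simulates.of_step {q q' : Stmt K A Λ σ} {hq : q ∈ stmtSet M L} {hq' : q' ∈ stmtSet M L}
    {v v' : σ} {T T' : K → List A} {op : StackOp K A} (h : StmtStep M q v op (some (q', v')))
    (ha : op.Acts T T') (he : TM2.stepAux q v T = TM2.stepAux q' v' T')
    (H : Simulates (ofTM2 M L l hl v₀) q' hq' v' T') :
    Simulates (ofTM2 M L l hl v₀) q hq v T := by
  have hs : (ofTM2 M L l hl v₀).Step (some (⟨q, hq⟩, v), T) (some (⟨q', hq'⟩, v'), T') :=
    ⟨op, ⟨_, rfl, h⟩, ha⟩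
  rw [Simulates, he]
  rcases H with ⟨v'', T'', h1, h2⟩ | ⟨l', v'', T'', hl', h1, h2⟩
  · exact .inl ⟨v'', T'', h1, .head hs h2⟩
  · exact .inr ⟨l', v'', T'', hl', h1, .head hs h2⟩

/-- By recursion on the statement. The finite control suffices, because `stmtSet M L` is closed
under substatements and the support condition keeps the targets of `goto` in `L`. -/
theorem simulates_ofTM2 (hL : ∀ l ∈ L, TM2.SupportsStmt L (M l)) (q : Stmt K A Λ σ)
    (hq : q ∈ stmtSet M L) (v : σ) (T : K → List A) :
    Simulates (ofTM2 M L l hl v₀) q hq v T := by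
  have sub : ∀ {q q' : Stmt K A Λ σ}, q ∈ stmtSet M L → q' ∈ TM2.stmts₁ q → q' ∈ stmtSet M L := by
    intro q q' hq hq'
    obtain ⟨l, hl, hql⟩ := mem_stmtSet.1 hq
    exact mem_stmtSet.2 ⟨l, hl, TM2.stmts₁_trans hql hq'⟩
  induction q generalizing v T with
  | push k f q ih =>
    have hq' := sub hq (q' := q) (by simp [TM2.stmts₁, TM2.stmts₁_self])
    exact Simulates.of_step (hq' := hq') (.push k f q v) ⟨T k, rfl, rfl⟩ rfl (ih hq' _ _)
  | peek k f q ih =>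
    have hq' := sub hq (q' := q) (by simp [TM2.stmts₁, TM2.stmts₁_self])
    cases hT : T k with
    | nil => exact Simulates.of_step (hq' := hq') (.peekNone k f q v) ⟨hT, rfl⟩ (by simp [TM2.stepAux, hT]) (ih hq' _ _)
    | cons a l =>
      refine Simulates.of_step (hq' := hq') (.peekSome k f q v a) (T' := T) ⟨l, hT, ?_⟩ (by simp [TM2.stepAux, hT])
        (ih hq' _ _)
      rw [if_pos rfl, ← hT, Function.update_eq_self]
  | pop k f q ih =>
    have hq' := sub hq (q' := q) (by simp [TM2.stmts₁, TM2.stmts₁_self])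
    cases hT : T k with
    | nil =>
      refine Simulates.of_step (hq' := hq') (.popNone k f q v) ⟨hT, rfl⟩ ?_ (ih hq' _ _)
      rw [TM2.stepAux, hT, List.tail_nil, ← hT, Function.update_eq_self, hT]
      rfl
    | cons a l =>
      exact Simulates.of_step (hq' := hq') (.popSome k f q v a) ⟨l, hT, rfl⟩ (by simp [TM2.stepAux, hT]) (ih hq' _ _)
  | load f q ih =>
    have hq' := sub hq (q' := q) (by simp [TM2.stmts₁, TM2.stmts₁_self])
    exact Simulates.of_step (hq' := hq') (.load f q v) rfl rfl (ih hq' _ _)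
  | branch f q₁ q₂ ih₁ ih₂ =>
    have h₁ := sub hq (q' := q₁) (by simp [TM2.stmts₁, TM2.stmts₁_self])
    have h₂ := sub hq (q' := q₂) (by simp [TM2.stmts₁, TM2.stmts₁_self])
    cases hf : f v
    · refine Simulates.of_step (hq' := h₂) (op := .skip) (T' := T)
        (by simpa [hf] using StmtStep.branch (M := M) f q₁ q₂ v) rfl
        (by simp [TM2.stepAux, hf]) (ih₂ h₂ _ _)
    · refine Simulates.of_step (hq' := h₁) (op := .skip) (T' := T)
        (by simpa [hf] using StmtStep.branch (M := M) f q₁ q₂ v) rfl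
        (by simp [TM2.stepAux, hf]) (ih₁ h₁ _ _)
  | goto f =>
    have hl' : f v ∈ L := by
      obtain ⟨l, hl, hql⟩ := mem_stmtSet.1 hq
      exact TM2.stmts₁_supportsStmt_mono hql (hL l hl) v
    exact .inr ⟨f v, v, T, mem_stmtSet.2 ⟨_, hl', TM2.stmts₁_self⟩, rfl,
      .single ⟨.skip, ⟨_, rfl, .goto f v⟩, rfl⟩⟩
  | halt => exact .inl ⟨v, T, rfl, .single ⟨.skip, ⟨_, rfl, .halt v⟩, rfl⟩⟩

/-- The stack machine halts iff the Turing machine does. -/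
theorem halts_ofTM2_iff (hL : ∀ l ∈ L, TM2.SupportsStmt L (M l)) (T : K → List A) :
    (ofTM2 M L l hl v₀).Halts (ofTM2 M L l hl v₀).init T ↔
      (StateTransition.eval (TM2.step M) ⟨some l, v₀, T⟩).Dom := by
  have first : ∀ (l : Λ) (v : σ) (T : K → List A),
      StateTransition.eval (TM2.step M) ⟨some l, v, T⟩ =
        StateTransition.eval (TM2.step M) (TM2.stepAux (M l) v T) :=
    fun l v T => StateTransition.reaches_eval (.single rfl)
  constructor
  · intro h
    rw [first]
    exact eval_dom_of_halts h _ _ rfl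
  · intro h
    obtain ⟨b, hb⟩ := Part.dom_iff_mem.1 h
    suffices H : ∀ l v T (hl' : M l ∈ stmtSet M L),
        b ∈ StateTransition.eval (TM2.step M) ⟨some l, v, T⟩ →
        (ofTM2 M L _ hl v₀).Halts (some (⟨M l, hl'⟩, v)) T from H _ _ _ _ hb
    intro l v T hl' hb
    generalize hx : (⟨some l, v, T⟩ : TM2.Cfg (fun _ : K => A) Λ σ) = x at hb
    obtain ⟨hr, hn⟩ := StateTransition.mem_eval.1 hb
    clear hb
    induction hr using Relation.ReflTransGen.head_induction_on generalizing l v T with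
    | refl => subst hx; cases hn
    | head h _ ih =>
      subst hx
      obtain rfl := Option.some.inj h
      rcases simulates_ofTM2 (hl := hl) (v₀ := v₀) hL (M l) hl' v T with
        ⟨v', T', h1, h2⟩ | ⟨l', v', T', hl'', h1, h2⟩
      · exact ⟨T', h2⟩
      · obtain ⟨T'', h3⟩ := ih l' v' T' hl'' h1.symm
        exact ⟨T'', h2.trans h3⟩

end StackMachine

/-! ### A universal stack machine -/

instance : Fintype Turing.PartrecToTM2.K' where
  elems := {.main, .rev, .aux, .stack}
  complete k := by cases k <;> simp

/-- Some stack machine with finitely many control states halts on the input that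
presents `m` iff the program with number `m` halts on `0`. -/
theorem exists_universal_stackMachine :
    ∃ (Q : Type) (_ : Fintype Q)
      (M : StackMachine Turing.PartrecToTM2.K' Turing.PartrecToTM2.Γ' Q),
      ∀ m : ℕ, M.Halts M.init
          (StackMachine.initStacks .main (Turing.PartrecToTM2.trNat m ++ [.cons])) ↔
        ((Denumerable.ofNat Nat.Partrec.Code m).eval 0).Dom := by
  -- A single code `c` computes this universal function, so `m` occurs only in the initial stack and
  -- the control `codeSupp c .halt` is fixed and finite.
  have hp : Partrec fun m : ℕ => (Denumerable.ofNat Nat.Partrec.Code m).eval 0 :=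
    Nat.Partrec.Code.eval_part.comp (Computable.ofNat _) (Computable.const 0)
  obtain ⟨c, hc⟩ := Turing.ToPartrec.Code.exists_code (Nat.Partrec'.part_iff₁.2 hp)
  have hsupp := Turing.PartrecToTM2.tr_supports c .halt
  refine ⟨_, inferInstance, StackMachine.ofTM2 Turing.PartrecToTM2.tr
    (Turing.PartrecToTM2.codeSupp c .halt) (Turing.PartrecToTM2.trNormal c .halt) hsupp.1 none,
    fun m => ?_⟩
  rw [StackMachine.halts_ofTM2_iff hsupp.2]
  have hinit : (⟨some (Turing.PartrecToTM2.trNormal c .halt), none,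
      StackMachine.initStacks .main (Turing.PartrecToTM2.trNat m ++ [.cons])⟩ :
        Turing.PartrecToTM2.Cfg') = Turing.PartrecToTM2.init c [m] := by
    rw [Turing.PartrecToTM2.init]
    congr 1
    funext k
    cases k <;> rfl
  have := Turing.PartrecToTM2.tr_eval c [m]
  rw [← hinit] at this
  refine (iff_of_eq (congrArg Part.Dom this)).trans ?_
  have hcm : c.eval [m] = _ := hc ⟨[m], rfl⟩
  rw [hcm]
  simp [List.Vector.head]

/-! ### The input as a probability -/

open Turing.PartrecToTM2 in
/-- The digits of the letters. -/
def letterDigit : Option Γ' → Fin 8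
  | none => 0
  | some .consₗ => 1
  | some .cons => 2
  | some .bit0 => 3
  | some .bit1 => 4

theorem letterDigit_injective : Function.Injective letterDigit := by
  rintro (_ | _ | _) (_ | _ | _) h <;> first | rfl | cases h

/-- One step of the computation of the input probability: the lowest bit of the third component
becomes the first digit of the fraction that the other components represent. -/
def inputStep (s : ℕ × ℕ × ℕ) : ℕ × ℕ × ℕ :=
  if s.2.2 = 0 then s else ((3 + s.2.2 % 2) * s.2.1 + s.1, 8 * s.2.1, s.2.2 / 2)

/-- The fraction of the binary expansion of `m`. -/
def inputState (m : ℕ) : ℕ × ℕ × ℕ := inputStep^[m] (1, 2, m)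

/-- The numerator of the input probability. -/
def inputNum (m : ℕ) : ℕ := 2 * (inputState m).2.1 + (inputState m).1

/-- The denominator of the input probability. -/
def inputDen (m : ℕ) : ℕ := 64 * (inputState m).2.1

theorem primrec_inputState : Primrec inputState := by
  have hs : Primrec inputStep := by
    have h1 : Primrec fun s : ℕ × ℕ × ℕ => s.2.1 := Primrec.fst.comp Primrec.snd
    have h2 : Primrec fun s : ℕ × ℕ × ℕ => s.2.2 := Primrec.snd.comp Primrec.snd
    refine Primrec.ite (Primrec.eq.comp h2 (Primrec.const 0)) Primrec.id ?_
    refine Primrec.pair (Primrec.nat_add.comp (Primrec.nat_mul.comp (Primrec.nat_add.comp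
      (Primrec.const 3) (Primrec.nat_mod.comp h2 (Primrec.const 2))) h1) Primrec.fst) ?_
    exact Primrec.pair (Primrec.nat_mul.comp (Primrec.const 8) h1)
      (Primrec.nat_div.comp h2 (Primrec.const 2))
  exact Primrec.nat_iterate Primrec.id
    (Primrec.pair (Primrec.const 1) (Primrec.pair (Primrec.const 2) Primrec.id))
    (hs.comp Primrec.snd).to₂

theorem primrec_inputNum : Primrec inputNum :=
  Primrec.nat_add.comp (Primrec.nat_mul.comp (Primrec.const 2)
    (Primrec.fst.comp (Primrec.snd.comp primrec_inputState))) (Primrec.fst.comp primrec_inputState)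

theorem primrec_inputDen : Primrec inputDen :=
  Primrec.nat_mul.comp (Primrec.const 64) (Primrec.fst.comp (Primrec.snd.comp primrec_inputState))

/-- The lowest bit comes first, which is also the bit that `inputStep` takes off. -/
theorem trNat_of_pos {m : ℕ} (hm : m ≠ 0) : Turing.PartrecToTM2.trNat m =
    (if m % 2 = 0 then .bit0 else .bit1) :: Turing.PartrecToTM2.trNat (m / 2) := by
  have key : ∀ p : PosNum, Turing.PartrecToTM2.trPosNum p =
      (if (p : ℕ) % 2 = 0 then .bit0 else .bit1) :: Turing.PartrecToTM2.trNat ((p : ℕ) / 2) := by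
    have tr : ∀ p : PosNum, Turing.PartrecToTM2.trNat p = Turing.PartrecToTM2.trPosNum p := by
      intro p
      rw [Turing.PartrecToTM2.trNat, PosNum.of_to_nat]
      rfl
    intro p
    cases p with
    | one => simp [Turing.PartrecToTM2.trPosNum]
    | bit0 p =>
      have h : ((PosNum.bit0 p : PosNum) : ℕ) = 2 * p := by rw [PosNum.cast_bit0]; ring
      rw [h, if_pos (by omega), show 2 * (p : ℕ) / 2 = p by omega, tr]
      rfl
    | bit1 p =>
      have h : ((PosNum.bit1 p : PosNum) : ℕ) = 2 * p + 1 := by rw [PosNum.cast_bit1]; ring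
      rw [h, if_neg (by omega), show (2 * (p : ℕ) + 1) / 2 = p by omega, tr]
      rfl
  have h : ((m : Num) : ℕ) = m := Num.to_of_nat m
  rw [Turing.PartrecToTM2.trNat]
  cases hn : (m : Num) with
  | zero => rw [hn] at h; exact absurd h.symm hm
  | pos p =>
    rw [hn] at h
    have hp : (p : ℕ) = m := h
    rw [Turing.PartrecToTM2.trNum, key, hp]

theorem digitValue_cons (x : ℝ) (c : Fin 8) (l : List (Fin 8)) :
    digitValue x (c :: l) = digitValue (((c : ℕ) + x) / 8) l := rfl

/-- The fraction starts at `1 / 2`, and each step puts the digit `3` or `4` of a bit in front. The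
`m` steps are enough, as halving makes a positive number smaller, and superfluous steps change
nothing. -/
theorem inputState_spec (m : ℕ) : ∃ k : ℕ, Odd (inputState m).1 ∧
    (inputState m).1 < (inputState m).2.1 ∧ (inputState m).2.1 = 2 ^ (k + 1) ∧
    ((inputState m).1 / (inputState m).2.1 : ℝ) =
      digitValue (1 / 2) ((Turing.PartrecToTM2.trNat m).map fun a => letterDigit (some a)) := by
  suffices H : ∀ n m p k : ℕ, m ≤ n → Odd p → p < 2 ^ (k + 1) → ∃ p' k' : ℕ, Odd p' ∧
      p' < 2 ^ (k' + 1) ∧ inputStep^[n] (p, 2 ^ (k + 1), m) = (p', 2 ^ (k' + 1), 0) ∧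
      (p' / 2 ^ (k' + 1) : ℝ) = digitValue (p / 2 ^ (k + 1))
        ((Turing.PartrecToTM2.trNat m).map fun a => letterDigit (some a)) by
    obtain ⟨p, k, hodd, hlt, he, hval⟩ := H m m 1 0 le_rfl odd_one (by simp)
    have hs : inputState m = (p, 2 ^ (k + 1), 0) := he
    rw [hs]
    refine ⟨k, hodd, hlt, rfl, ?_⟩
    simpa using hval
  intro n
  induction n with
  | zero =>
    intro m p k hm hodd hlt
    obtain rfl : m = 0 := by omega
    exact ⟨p, k, hodd, hlt, rfl, by simp [digitValue]⟩
  | succ n ih =>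
    intro m p k hm hodd hlt
    rw [Function.iterate_succ_apply]
    by_cases h0 : m = 0
    · subst h0
      have : inputStep (p, 2 ^ (k + 1), 0) = (p, 2 ^ (k + 1), 0) := by simp [inputStep]
      rw [this]
      exact ih 0 p k (by omega) hodd hlt
    · have hs : inputStep (p, 2 ^ (k + 1), m) =
          ((3 + m % 2) * 2 ^ (k + 1) + p, 2 ^ (k + 3 + 1), m / 2) := by
        simp only [inputStep, if_neg h0, Prod.mk.injEq, true_and, and_true]
        ring
      have h8 : 2 ^ (k + 3 + 1) = 8 * 2 ^ (k + 1) := by ring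
      obtain ⟨p', k', h1, h2, h3, h4⟩ := ih (m / 2) ((3 + m % 2) * 2 ^ (k + 1) + p) (k + 3)
        (by omega) (Even.add_odd (Even.mul_left (by simp [Nat.even_pow]) _) hodd) (by
          rw [h8]
          have : m % 2 ≤ 1 := by omega
          nlinarith)
      refine ⟨p', k', h1, h2, by rw [hs, h3], ?_⟩
      rw [h4, trNat_of_pos h0, List.map_cons]
      have h8' : (2 : ℝ) ^ (k + 3 + 1) = 8 * 2 ^ (k + 1) := by ring
      rw [digitValue_cons, h8']
      congr 1
      rcases Nat.mod_two_eq_zero_or_one m with h | h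
      · have : ((letterDigit (some (if m % 2 = 0 then .bit0 else .bit1)) : Fin 8) : ℕ) = 3 := by
          rw [if_pos h]; rfl
        rw [this, h]
        push_cast
        field_simp
      · have : ((letterDigit (some (if m % 2 = 0 then .bit0 else .bit1)) : Fin 8) : ℕ) = 4 := by
          rw [if_neg (by omega)]; rfl
        rw [this, h]
        push_cast
        field_simp

theorem inputNum_lt_inputDen (m : ℕ) : inputNum m < inputDen m := by
  obtain ⟨k, -, h, -, -⟩ := inputState_spec m
  simp only [inputNum, inputDen]
  omega

theorem inputNum_pos (m : ℕ) : 0 < inputNum m := by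
  obtain ⟨k, hodd, -⟩ := inputState_spec m
  have := hodd.pos
  simp only [inputNum]
  omega

/-- An odd number over a power of two. Lowest terms matter because the code of a process contains
the reduced numerator and denominator. -/
theorem coprime_inputNum_inputDen (m : ℕ) : (inputNum m).Coprime (inputDen m) := by
  obtain ⟨k, hodd, -, hden, -⟩ := inputState_spec m
  have : inputDen m = 2 ^ (k + 7) := by rw [inputDen, hden]; ring
  rw [this]
  refine Nat.Coprime.pow_right _ (Nat.coprime_two_right.2 ?_)
  rw [inputNum]
  exact Even.add_odd (even_two_mul _) hodd

/-- The input probability. -/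
def inputProb (m : ℕ) : ℚ := inputNum m / inputDen m

theorem inputDen_pos (m : ℕ) : 0 < inputDen m := (inputNum_pos m).trans (inputNum_lt_inputDen m)

theorem inputProb_mem_Ioo (m : ℕ) : inputProb m ∈ Set.Ioo 0 1 := by
  have h0 : (0 : ℚ) < inputNum m := by exact_mod_cast inputNum_pos m
  have h1 : (inputNum m : ℚ) < inputDen m := by exact_mod_cast inputNum_lt_inputDen m
  have h2 : (0 : ℚ) < inputDen m := h0.trans h1
  exact ⟨div_pos h0 h2, (div_lt_one h2).2 h1⟩

/-- The digit `2` of `cons` and the digit `0` of the end marker come last, and `(0 + (2 + x) / 8) /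
8 = (2 + x) / 64`. -/
theorem inputProb_eq_digitValue (m : ℕ) : (inputProb m : ℝ) = digitValue (1 / 2)
    (((Turing.PartrecToTM2.trNat m ++ [Turing.PartrecToTM2.Γ'.cons]).map some ++ [none]).map letterDigit) := by
  obtain ⟨k, -, -, hden, h⟩ := inputState_spec m
  have hpos : (0 : ℝ) < (inputState m).2.1 := by rw [hden]; positivity
  have e : ((Turing.PartrecToTM2.trNat m ++ [Turing.PartrecToTM2.Γ'.cons]).map some ++ [none]).map letterDigit =
      ((Turing.PartrecToTM2.trNat m).map fun a => letterDigit (some a)) ++ [2] ++ [0] := by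
    simp [Function.comp_def, letterDigit]
  rw [e, digitValue_concat, digitValue_concat, ← h, inputProb, inputNum, inputDen]
  have h2 : ((2 : Fin 8) : ℕ) = 2 := rfl
  rw [h2]
  push_cast
  field_simp
  simp
  ring

theorem num_den_inputProb (m : ℕ) :
    (inputProb m).num.natAbs = inputNum m ∧ (inputProb m).den = inputDen m := by
  have hd : (0 : ℤ) < inputDen m := by exact_mod_cast inputDen_pos m
  have hc : (inputNum m : ℤ).natAbs.Coprime (inputDen m : ℤ).natAbs := by
    simpa using coprime_inputNum_inputDen m
  have hn := Rat.num_div_eq_of_coprime hd hc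
  have hd' := Rat.den_div_eq_of_coprime hd hc
  push_cast at hn hd'
  constructor
  · rw [inputProb, hn]; simp
  · rw [inputProb]; exact_mod_cast hd'

theorem num_den_one_sub_inputProb (m : ℕ) :
    (1 - inputProb m).num.natAbs = inputDen m - inputNum m ∧
      (1 - inputProb m).den = inputDen m := by
  have hlt := inputNum_lt_inputDen m
  have hd : (0 : ℤ) < inputDen m := by exact_mod_cast inputDen_pos m
  have hc : ((inputDen m - inputNum m : ℕ) : ℤ).natAbs.Coprime (inputDen m : ℤ).natAbs := by
    simpa [Nat.coprime_self_sub_left hlt.le] using coprime_inputNum_inputDen m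
  have hn := Rat.num_div_eq_of_coprime hd hc
  have hd' := Rat.den_div_eq_of_coprime hd hc
  have e : 1 - inputProb m = (((inputDen m - inputNum m : ℕ) : ℤ) : ℚ) / ((inputDen m : ℤ) : ℚ) := by
    have : (inputDen m : ℚ) ≠ 0 := by exact_mod_cast (inputDen_pos m).ne'
    rw [inputProb]
    push_cast [Nat.cast_sub hlt.le]
    field_simp
  rw [e]
  constructor
  · rw [hn]; simp
  · exact_mod_cast hd'

/-! ### Computability of the instances -/

/-- The list `l` is fixed, so nothing has to be computable in `b`. -/
theorem Computable.list_map_const {α β γ : Type} [Primcodable α] [Primcodable γ] (l : List β)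
    {g : β → α → γ} (hg : ∀ b, Computable (g b)) : Computable fun a => l.map fun b => g b a := by
  induction l with
  | nil => exact Computable.const []
  | cons b l ih => exact Computable.list_cons.comp (hg b) ih

namespace AffineAutomaton

variable {Q S J : Type} [Fintype Q] [Fintype S] (A : AffineAutomaton Q S J)

/-- The numbering of the symbols and the order of the rules are chosen noncomputably, but once for
all `m`. Only the two probabilities at `bot` vary with `m`. -/
theorem computable_code_process :
    Computable fun m => (A.process (inputProb m) (inputProb_mem_Ioo m)).code := by
  unfold PBPA.code
  refine Computable.list_ofFn fun X => ?_
  change Computable fun m => ((A.rhs (A.symEquiv.symm X)).toList.map (List.map A.symEquiv)).map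
    fun α : List (Fin (Fintype.card A.Sym)) => (α.map Fin.val,
      (A.weight (inputProb m) (A.symEquiv.symm X) (α.map A.symEquiv.symm)).num.natAbs,
      (A.weight (inputProb m) (A.symEquiv.symm X) (α.map A.symEquiv.symm)).den)
  refine Computable.list_map_const (g := fun (α : List (Fin (Fintype.card A.Sym))) m => (α.map Fin.val,
      (A.weight (inputProb m) (A.symEquiv.symm X) (α.map A.symEquiv.symm)).num.natAbs,
      (A.weight (inputProb m) (A.symEquiv.symm X) (α.map A.symEquiv.symm)).den)) _ fun α => ?_
  refine (Computable.const _).pair ?_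
  unfold weight
  split_ifs
  · simp only [num_den_inputProb]
    exact primrec_inputNum.to_comp.pair primrec_inputDen.to_comp
  · simp only [num_den_one_sub_inputProb]
    exact (Primrec.nat_sub.comp primrec_inputDen primrec_inputNum).to_comp.pair
      primrec_inputDen.to_comp
  · exact Computable.const _
  · exact Computable.const _

variable [Fintype J]

/-! ### The valuations -/

open scoped Classical in
/-- The propositions as a simple valuation. -/
noncomputable def simpleValuation :
    SimpleValuation (Fintype.card A.Sym) (numProps (J := J)) := fun p x =>
  decide (∃ y ∈ x, A.Label (propEquiv.symm p) (A.symEquiv.symm y))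

theorem toSet_simpleValuation (p : Option (J × Bool)) :
    A.simpleValuation.toSet (propEquiv p) = A.labelSet p := by
  ext w
  simp [SimpleValuation.toSet, simpleValuation, labelSet]

end AffineAutomaton

/-- The automaton of a set of heads: it remembers the last letter that it has read. -/
def FinDFA.ofHeads {n : ℕ} (H : Option (Fin n) → Bool) : FinDFA n where
  size := n + 1
  step _ X := X.succ
  start := 0
  accept := Fin.cases (H none) fun X => H (some X)

/-- Read from bottom to top, the last letter is the top of the stack; the state `0` is left at the
first letter and never entered again. -/
theorem FinDFA.reverse_mem_accepts_ofHeads {n : ℕ} (H : Option (Fin n) → Bool)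
    (w : Config n) : w.reverse ∈ (FinDFA.ofHeads H).toDFA.accepts ↔ H w.head? = true := by
  cases w with
  | nil => rfl
  | cons X w =>
    rw [List.reverse_cons, DFA.mem_accepts, DFA.eval, DFA.evalFrom_append_singleton]
    rfl

/-- A simple valuation as a regular one. -/
def SimpleValuation.toRegular {n k : ℕ} (H : SimpleValuation n k) : RegularValuation n k :=
  fun p => FinDFA.ofHeads (H p)

theorem SimpleValuation.toSet_toRegular {n k : ℕ} (H : SimpleValuation n k) :
    H.toRegular.toSet = H.toSet := by
  funext p
  ext w
  exact FinDFA.reverse_mem_accepts_ofHeads (H p) w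

/-! ### Undecidability -/

/-- The halting problem reduces to every problem whose instances include a computable family
that answers it. -/
theorem not_decidableProblem_of_halting {ι C : Type} [Primcodable C] {code : ι → C}
    {P : ι → Prop} (inst : ℕ → ι) (hcode : Computable fun m => code (inst m))
    (h : ∀ m, P (inst m) ↔ ((Denumerable.ofNat Nat.Partrec.Code m).eval 0).Dom) :
    ¬ DecidableProblem code P := by
  rintro ⟨f, hf, hfP⟩
  refine ComputablePred.halting_problem 0 (ComputablePred.computable_iff.2
    ⟨fun c => f (code (inst (Encodable.encode c))),
      hf.comp (hcode.comp Computable.encode), funext fun c => propext ?_⟩)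
  rw [hfP, h, Denumerable.ofNat_encode]

/-- The model-checking problems are undecidable if some affine automaton has a word with all
values one half for exactly the input probabilities of the programs that halt. -/
theorem not_decidableProblem_of_affineAutomaton {Q S J : Type} [Fintype Q] [Fintype S] [Fintype J]
    (A : AffineAutomaton Q S J)
    (h : ∀ m, (∃ w, A.Path A.start w A.final ∧ ∀ j, A.value (inputProb m) j w = 1 / 2) ↔
      ((Denumerable.ofNat Nat.Partrec.Code m).eval 0).Dom) :
    ¬ DecidableProblem MCInstance.simpleCode MCInstance.SimpleSat ∧
      ¬ DecidableProblem MCInstance.regularCode MCInstance.RegularSat := by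
  have key : ∀ m, AffineAutomaton.formula.Sat
      (A.process (inputProb m) (inputProb_mem_Ioo m)).chain A.simpleValuation.toSet
      [A.symEquiv .start] ↔ ((Denumerable.ofNat Nat.Partrec.Code m).eval 0).Dom := fun m => by
    rw [A.sat_formula_iff _ _ A.toSet_simpleValuation, h]
  constructor
  · refine not_decidableProblem_of_halting (fun m => ⟨_, _,
      A.process (inputProb m) (inputProb_mem_Ioo m), A.symEquiv .start, A.simpleValuation,
      AffineAutomaton.formula⟩) ?_ key
    exact A.computable_code_process.pair (Computable.const
      ((A.symEquiv .start).val, A.simpleValuation.code, AffineAutomaton.formula.code))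
  · refine not_decidableProblem_of_halting (fun m => ⟨_, _,
      A.process (inputProb m) (inputProb_mem_Ioo m), A.symEquiv .start,
      A.simpleValuation.toRegular, AffineAutomaton.formula⟩) ?_ fun m => ?_
    · exact A.computable_code_process.pair (Computable.const
        ((A.symEquiv .start).val, A.simpleValuation.toRegular.code, AffineAutomaton.formula.code))
    · rw [MCInstance.RegularSat, SimpleValuation.toSet_toRegular]
      exact key m

theorem theorem1 :
    ¬ DecidableProblem MCInstance.simpleCode MCInstance.SimpleSat ∧
      ¬ DecidableProblem MCInstance.regularCode MCInstance.RegularSat := by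
  obtain ⟨Q, _, M, hM⟩ := exists_universal_stackMachine
  refine not_decidableProblem_of_affineAutomaton (M.histAutomaton letterDigit .main) fun m => ?_
  rw [← hM]
  exact M.exists_value_eq_half_iff letterDigit .main letterDigit_injective _
    (inputProb_eq_digitValue m)
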